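/- **Setting.** Let $M,N$ be smooth $m$-dimensional manifolds (Hausdorff), $h:M\to N$ and $\eta:N\to M$ diffeomorphisms, $E\to M$ a smooth real vector bundle of rank $r$ with dual bundle $\pi:E^*\to M$, and $F\to N$ a smooth real vector bundle of rank $p$ with a generalized Lie algebroid structure: a vector bundle morphism $\rho:F\to TM$ over $\eta$ and a real Lie bracket $[\,,]$ on $\Gamma(F)$ such that, writing $\theta(u)$ for the vector field on $N$ with $\theta(u)(h\eta(\varkappa))=Th(\rho(u(\varkappa)))$, one has $[u,fv]=f[u,v]+\theta(u)(f)\,v$ and $\theta([u,v])=[\theta(u),\theta(v)]$ for all $u,v\in\Gamma(F)$, $f\in C^\infty(N)$. For $x\in M$ let $a_x:F_{h(x)}\to T_xM$ be the anchor along $h$, i.e. $a_x=\rho|_{F_{h(x)}}$ if $\eta(h(x))=x$, and $a_x=0$ otherwise (the axioms force $\rho|_{F_{h(x)}}=0$ in the second case). The generalized tangent bundle $L=(\rho,\eta)TE^*\to E^*$ has fibre $L_u=\{(z,w)\in F_{h(\pi u)}\times T_uE^* : T\pi(w)=a_{\pi u}(z)\}$; an element $(z,w)$ acts on functions $f$ on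 $E^*$ by $(z,w)f=w f$. The vertical subbundle $V\subset L$ consists of the elements $(0,w)$. A $(\rho,\eta)$-connection is a smooth bundle morphism $\Gamma:L\to V$ which is the identity on $V$; its kernel $H$ is the horizontal subbundle, so $L=H\oplus V$. Given smooth local frames $(t_\alpha)_{\alpha\le p}$ of $F$ over an open $W\subset N$ and $(e^a)_{a\le r}$ of $E^*$ over an open $U\subset M$, the adapted base over $\{u:\pi u\in U,\ h(\pi u)\in W\}$ consists of the horizontal sections $\delta_\alpha$ with first component $t_\alpha\circ h\circ\pi$ and of the vertical sections $\partial^a=(0,\partial/\partial p_a)$, where $\partial/\partial p_a$ at $u$ is the velocity at $s=0$ of $s\mapsto u+s\,e^a(\pi u)$. A distinguished linear $(\rho,\eta)$-connection is a covariant derivative $D$ on $L$ ($D_X\sigma$ is $C^\infty(E^*)$-linear in $X$, additive in $\sigma$, and $D_X(f\sigma)=fD_X\sigma+(Xf)\sigma$) that maps horizontal sections to horizontal sections and vertical sections to vertical sections. Its components $(H^\alpha_{\beta\gamma},H^a_{b\gamma},V^{\alpha c}_\beta,V^{ac}_b)$ are the local functions determined by $$D_{\delta_\gamma}\delta_\beta=H^\alpha_{\beta\gamma}\delta_\alpha,\quad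 D_{\delta_\gamma}\partial^a=H^a_{b\gamma}\partial^b,\quad D_{\partial^c}\delta_\beta=V^{\alpha c}_\beta\delta_\alpha,\quad D_{\partial^c}\partial^a=V^{ac}_b\partial^b .$$ A pseudometrical structure $G$ is a smooth symmetric bilinear form on $L$ with $G(H,V)=0$ whose restrictions to $H$ and to $V$ are nondegenerate at every point (a metrical structure is one whose restrictions have, in addition, constant signature). Put $g_{\alpha\beta}=G(\delta_\alpha,\delta_\beta)$, $g^{ab}=G(\partial^a,\partial^b)$, and let $(\tilde g^{\alpha\beta})$, $(\tilde g_{ab})$ be the inverse matrices. Moreover $(D_XG)(\sigma,\tau)=X(G(\sigma,\tau))-G(D_X\sigma,\tau)-G(\sigma,D_X\tau)$. **Theorem.** Let $\Gamma$ be a $(\rho,\eta)$-connection, $\mathring D$ a distinguished linear $(\rho,\eta)$-connection and $G$ a (pseudo)metrical structure. Denote by $\mathring H,\mathring V$ the components of $\mathring D$ and put $$g_{\varepsilon\beta\overset{0}{|}\gamma}=\delta_\gamma(g_{\varepsilon\beta})-\mathring H^{\theta}_{\varepsilon\gamma}g_{\theta\beta}-\mathring H^{\theta}_{\beta\gamma}g_{\varepsilon\theta},\qquad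 g^{ea}{}_{\overset{0}{|}\gamma}=\delta_\gamma(g^{ea})-\mathring H^{e}_{d\gamma}g^{da}-\mathring H^{a}_{d\gamma}g^{ed},$$ $$g_{\varepsilon\beta}\overset{0}{|}{}^{c}=\partial^c(g_{\varepsilon\beta})-\mathring V^{\theta c}_{\varepsilon}g_{\theta\beta}-\mathring V^{\theta c}_{\beta}g_{\varepsilon\theta},\qquad g^{ea}\overset{0}{|}{}^{c}=\partial^c(g^{ea})-\mathring V^{ec}_{d}g^{da}-\mathring V^{ac}_{d}g^{ed}.$$ Then there is a distinguished linear $(\rho,\eta)$-connection $D$ whose components in every adapted base are $$H^\alpha_{\beta\gamma}=\mathring H^\alpha_{\beta\gamma}+\tfrac12\tilde g^{\alpha\varepsilon}g_{\varepsilon\beta\overset{0}{|}\gamma},\qquad H^a_{b\gamma}=\mathring H^a_{b\gamma}+\tfrac12\tilde g_{be}\,g^{ea}{}_{\overset{0}{|}\gamma},$$ $$V^{\alpha c}_\beta=\mathring V^{\alpha c}_\beta+\tfrac12\tilde g^{\alpha\varepsilon}g_{\varepsilon\beta}\overset{0}{|}{}^{c},\qquad V^{ac}_b=\mathring V^{ac}_b+\tfrac12\tilde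 g_{be}\,g^{ea}\overset{0}{|}{}^{c},$$ and it satisfies $D_XG=0$ for all $X\in\Gamma(L)$; that is, the generalized tangent bundle becomes $(\rho,\eta)$-(pseudo)metrizable. -/

import Mathlib

open Bundle Set
open scoped Manifold ContDiff Topology

set_option linter.unusedSectionVars false

namespace GenTangent

noncomputable section

/-- Transport of tangent vectors along an equality of base points. -/
def transport {EM : Type*} [NormedAddCommGroup EM] [NormedSpace ℝ EM]
    {HM : Type*} [TopologicalSpace HM] (I : ModelWithCorners ℝ EM HM)
    {M : Type*} [TopologicalSpace M] [ChartedSpace HM M] {x y : M} (hxy : x = y) :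
    TangentSpace I x →ₗ[ℝ] TangentSpace I y :=
  hxy ▸ LinearMap.id

/-- The derivative `v f` of a real function `f` along a tangent vector `v`. -/
def dirDeriv {EM : Type*} [NormedAddCommGroup EM] [NormedSpace ℝ EM]
    {HM : Type*} [TopologicalSpace HM] (I : ModelWithCorners ℝ EM HM)
    {M : Type*} [TopologicalSpace M] [ChartedSpace HM M] (f : M → ℝ) {x : M}
    (v : TangentSpace I x) : ℝ :=
  mfderiv I 𝓘(ℝ, ℝ) f x v

theorem mfderiv_transport {E₁ : Type*} [NormedAddCommGroup E₁] [NormedSpace ℝ E₁]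
    {H₁ : Type*} [TopologicalSpace H₁] (I₁ : ModelWithCorners ℝ E₁ H₁)
    {M₁ : Type*} [TopologicalSpace M₁] [ChartedSpace H₁ M₁]
    {E₂ : Type*} [NormedAddCommGroup E₂] [NormedSpace ℝ E₂]
    {H₂ : Type*} [TopologicalSpace H₂] (I₂ : ModelWithCorners ℝ E₂ H₂)
    {M₂ : Type*} [TopologicalSpace M₂] [ChartedSpace H₂ M₂]
    (f : M₁ → M₂) {a b : M₁} (hab : a = b) (v : TangentSpace I₁ a) :
    mfderiv I₁ I₂ f b (transport I₁ hab v) =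
      transport I₂ (congrArg f hab) (mfderiv I₁ I₂ f a v) := by
  subst hab
  rfl

section Algebroid

variable {EM : Type*} [NormedAddCommGroup EM] [NormedSpace ℝ EM]
  {M : Type*} [TopologicalSpace M] [ChartedSpace EM M]
  {N : Type*} [TopologicalSpace N] [ChartedSpace EM N]
  {F₀ : Type*} [NormedAddCommGroup F₀] [NormedSpace ℝ F₀]
  {F : N → Type*} [TopologicalSpace (TotalSpace F₀ F)]
  [∀ y, AddCommGroup (F y)] [∀ y, Module ℝ (F y)] [∀ y, TopologicalSpace (F y)]
  [FiberBundle F₀ F] [VectorBundle ℝ F₀ F]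

/-- The vector field `Γ(Th ∘ ρ, h ∘ η)(u)` on `N` attached to a section `u` of `F`:
its value at `y = h (η ϰ)` is `Th (ρ (u ϰ))`. -/
def anchorField (h : M ≃ₘ^∞⟮𝓘(ℝ, EM), 𝓘(ℝ, EM)⟯ N) (η : N ≃ₘ^∞⟮𝓘(ℝ, EM), 𝓘(ℝ, EM)⟯ M)
    (ρ : ∀ y, F y →ₗ[ℝ] TangentSpace 𝓘(ℝ, EM) (η y)) (u : ∀ y, F y) (y : N) :
    TangentSpace 𝓘(ℝ, EM) y :=
  transport 𝓘(ℝ, EM) (show h (η (η.symm (h.symm y))) = y by simp)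
    (mfderiv 𝓘(ℝ, EM) 𝓘(ℝ, EM) h (η (η.symm (h.symm y)))
      (ρ (η.symm (h.symm y)) (u (η.symm (h.symm y)))))

variable (F₀ F) in
/-- A generalized Lie algebroid `((F, ν, N), [,]_{F,h}, (ρ, η))`. -/
structure GenLieAlgebroid [IsManifold 𝓘(ℝ, EM) ∞ M] [IsManifold 𝓘(ℝ, EM) ∞ N]
    [ContMDiffVectorBundle ∞ F₀ F 𝓘(ℝ, EM)]
    (h : M ≃ₘ^∞⟮𝓘(ℝ, EM), 𝓘(ℝ, EM)⟯ N) (η : N ≃ₘ^∞⟮𝓘(ℝ, EM), 𝓘(ℝ, EM)⟯ M) where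
  /-- the vector bundle morphism `(ρ, η)` from `F` to `TM` -/
  ρ : ∀ y, F y →ₗ[ℝ] TangentSpace 𝓘(ℝ, EM) (η y)
  ρ_smooth : ContMDiff (𝓘(ℝ, EM).prod 𝓘(ℝ, F₀)) 𝓘(ℝ, EM).tangent ∞
    (fun z : TotalSpace F₀ F ↦ (⟨η z.proj, ρ z.proj z.2⟩ : TangentBundle 𝓘(ℝ, EM) M))
  /-- the bracket of smooth sections of `F` -/
  bracket : Cₛ^∞⟮𝓘(ℝ, EM); F₀, F⟯ → Cₛ^∞⟮𝓘(ℝ, EM); F₀, F⟯ → Cₛ^∞⟮𝓘(ℝ, EM); F₀, F⟯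
  bracket_add_left : ∀ u v w, bracket (u + v) w = bracket u w + bracket v w
  bracket_add_right : ∀ u v w, bracket u (v + w) = bracket u v + bracket u w
  bracket_smul_left : ∀ (c : ℝ) u v, bracket (c • u) v = c • bracket u v
  bracket_smul_right : ∀ (c : ℝ) u v, bracket u (c • v) = c • bracket u v
  bracket_self : ∀ u, bracket u u = 0
  jacobi : ∀ u v w,
    bracket u (bracket v w) + bracket v (bracket w u) + bracket w (bracket u v) = 0
  /-- `[u, f v] = f [u, v] + (Γ(Th ∘ ρ, h ∘ η)(u) f) v` -/
  leibniz : ∀ (u v fv : Cₛ^∞⟮𝓘(ℝ, EM); F₀, F⟯) (f : N → ℝ), ContMDiff 𝓘(ℝ, EM) 𝓘(ℝ, ℝ) ∞ f →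
    (∀ y, fv y = f y • v y) → ∀ y, bracket u fv y =
      f y • bracket u v y
        + dirDeriv 𝓘(ℝ, EM) f (anchorField h η ρ u y) • v y
  /-- `Γ(Th ∘ ρ, h ∘ η)` is a morphism of Lie algebras into the vector fields on `N` -/
  anchor_bracket : ∀ (u v : Cₛ^∞⟮𝓘(ℝ, EM); F₀, F⟯) (y : N),
    anchorField h η ρ (bracket u v) y =
      VectorField.mlieBracket 𝓘(ℝ, EM) (anchorField h η ρ u) (anchorField h η ρ v) y

end Algebroid

section GeneralizedTangentBundle

variable {EM : Type*} [NormedAddCommGroup EM] [NormedSpace ℝ EM]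
  {M : Type*} [TopologicalSpace M] [ChartedSpace EM M] [IsManifold 𝓘(ℝ, EM) ∞ M]
  {N : Type*} [TopologicalSpace N] [ChartedSpace EM N] [IsManifold 𝓘(ℝ, EM) ∞ N]
  {F₀ : Type*} [NormedAddCommGroup F₀] [NormedSpace ℝ F₀]
  {F : N → Type*} [TopologicalSpace (TotalSpace F₀ F)]
  [∀ y, AddCommGroup (F y)] [∀ y, Module ℝ (F y)] [∀ y, TopologicalSpace (F y)]
  [FiberBundle F₀ F] [VectorBundle ℝ F₀ F] [ContMDiffVectorBundle ∞ F₀ F 𝓘(ℝ, EM)]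
  {h : M ≃ₘ^∞⟮𝓘(ℝ, EM), 𝓘(ℝ, EM)⟯ N} {η : N ≃ₘ^∞⟮𝓘(ℝ, EM), 𝓘(ℝ, EM)⟯ M}

open Classical in
/-- The anchor along `h`: the linear map `F_{h x} → T_x M`, `z^α t_α ↦ z^α ρ^i_α(h x) ∂_i`.
Here `ρ (h x)` takes its values in the tangent space at `η (h x)`.  The axioms of a generalized
Lie algebroid force `ρ (h x) = 0` wherever `η (h x) ≠ x`, so there the map is zero. -/
def GenLieAlgebroid.anchorAt (A : GenLieAlgebroid F₀ F h η) (x : M) :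
    F (h x) →ₗ[ℝ] TangentSpace 𝓘(ℝ, EM) x :=
  if hx : η (h x) = x then (transport 𝓘(ℝ, EM) hx).comp (A.ρ (h x)) else 0

variable {P₀ : Type*} [NormedAddCommGroup P₀] [NormedSpace ℝ P₀]
  {P : M → Type*} [TopologicalSpace (TotalSpace P₀ P)]
  [∀ x, AddCommGroup (P x)] [∀ x, Module ℝ (P x)] [∀ x, TopologicalSpace (P x)]
  [FiberBundle P₀ P] [VectorBundle ℝ P₀ P] [ContMDiffVectorBundle ∞ P₀ P 𝓘(ℝ, EM)]

/-- The fibre at `u` of the generalized tangent bundle `(ρ, η)TP` of a vector bundle `P → M`: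
the pairs `(z, w) ∈ F_{h(π u)} × T_u P` with `Tπ w` equal to the anchor of `z`.  In local
coordinates this is the span of `T_α ⊕ (ρ^i_α ∘ h ∘ π) ∂_i` and `0 ⊕ ∂/∂p_a`. -/
def Fib (A : GenLieAlgebroid F₀ F h η) (u : TotalSpace P₀ P) :
    Submodule ℝ (F (h u.proj) × TangentSpace (𝓘(ℝ, EM).prod 𝓘(ℝ, P₀)) u) :=
  LinearMap.eqLocus
    ((mfderiv (𝓘(ℝ, EM).prod 𝓘(ℝ, P₀)) 𝓘(ℝ, EM) (TotalSpace.proj : TotalSpace P₀ P → M)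
      u).toLinearMap.comp (LinearMap.snd ℝ _ _))
    ((A.anchorAt u.proj).comp (LinearMap.fst ℝ _ _))

/-- The vertical subspace: the kernel of `(z, w) ↦ z`. -/
def Vert (A : GenLieAlgebroid F₀ F h η) (u : TotalSpace P₀ P) : Submodule ℝ (Fib A u) :=
  LinearMap.ker ((LinearMap.fst ℝ _ _).comp (Fib A u).subtype)

/-- Smoothness on `O` of a section `u ↦ (z u, w u)` of the generalized tangent bundle: `z` is
smooth as a map into the total space of `F`, and `w` is a smooth vector field. -/
def SmoothSec (A : GenLieAlgebroid F₀ F h η) (O : Set (TotalSpace P₀ P))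
    (X : ∀ u : TotalSpace P₀ P, Fib A u) : Prop :=
  ContMDiffOn (𝓘(ℝ, EM).prod 𝓘(ℝ, P₀)) (𝓘(ℝ, EM).prod 𝓘(ℝ, F₀)) ∞
      (fun u ↦ (⟨h u.proj, (X u).1.1⟩ : TotalSpace F₀ F)) O ∧
    ContMDiffOn (𝓘(ℝ, EM).prod 𝓘(ℝ, P₀)) (𝓘(ℝ, EM).prod 𝓘(ℝ, P₀)).tangent ∞
      (fun u ↦ (⟨u, (X u).1.2⟩ :
        TangentBundle (𝓘(ℝ, EM).prod 𝓘(ℝ, P₀)) (TotalSpace P₀ P))) O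

/-- The derivative `Γ(ρ̃, Id)(ξ) f` of a function `f` on `P` along `ξ = (z, w)`, that is `w f`. -/
def deriv (A : GenLieAlgebroid F₀ F h η) (f : TotalSpace P₀ P → ℝ) {u : TotalSpace P₀ P}
    (ξ : Fib A u) : ℝ :=
  dirDeriv (𝓘(ℝ, EM).prod 𝓘(ℝ, P₀)) f ξ.1.2

variable (P₀ P) in
/-- A `(ρ, η)`-connection for `P`: a smooth left splitting `Γ` of the inclusion of the vertical
subbundle into the generalized tangent bundle. -/
structure Connection (A : GenLieAlgebroid F₀ F h η) where
  Γ : ∀ u : TotalSpace P₀ P, Fib A u →ₗ[ℝ] Vert A u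
  split : ∀ (u : TotalSpace P₀ P) (ξ : Vert A u), Γ u (ξ : Fib A u) = ξ
  smooth : ∀ (O : Set (TotalSpace P₀ P)), IsOpen O → ∀ X : ∀ u, Fib A u,
    SmoothSec A O X → SmoothSec A O (fun u ↦ (Γ u (X u) : Fib A u))

/-- The horizontal subspace: the kernel of the connection. -/
def Horiz {A : GenLieAlgebroid F₀ F h η} (C : Connection P₀ P A) (u : TotalSpace P₀ P) :
    Submodule ℝ (Fib A u) :=
  LinearMap.ker (C.Γ u)

/-- The projection of a vector bundle is a submersion. -/
theorem proj_surjective (u : TotalSpace P₀ P) :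
    Function.Surjective (mfderiv (𝓘(ℝ, EM).prod 𝓘(ℝ, P₀)) 𝓘(ℝ, EM)
      (TotalSpace.proj : TotalSpace P₀ P → M) u) := by
  set e := trivializationAt P₀ P u.proj with he
  have hu : u.proj ∈ e.baseSet := mem_baseSet_trivializationAt P₀ P u.proj
  let s : M → TotalSpace P₀ P := fun x ↦ e.toOpenPartialHomeomorph.symm (x, (e u).2)
  have hsu : s u.proj = u := e.symm_apply_mk_proj (e.mem_source.mpr hu)
  have hs : MDifferentiableAt 𝓘(ℝ, EM) (𝓘(ℝ, EM).prod 𝓘(ℝ, P₀)) s u.proj := by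
    have h1 : ContMDiffAt (𝓘(ℝ, EM).prod 𝓘(ℝ, P₀)) (𝓘(ℝ, EM).prod 𝓘(ℝ, P₀)) ∞
        e.toOpenPartialHomeomorph.symm (u.proj, (e u).2) :=
      (e.contMDiffOn_symm (IB := 𝓘(ℝ, EM)) (n := ∞)).contMDiffAt
        (e.open_target.mem_nhds (e.mem_target.mpr hu))
    have h2 : ContMDiffAt 𝓘(ℝ, EM) (𝓘(ℝ, EM).prod 𝓘(ℝ, P₀)) ∞
        (fun x : M ↦ (x, (e u).2)) u.proj := contMDiffAt_id.prodMk contMDiffAt_const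
    exact (ContMDiffAt.comp u.proj h1 h2).mdifferentiableAt (by simp)
  have hπ : MDifferentiableAt (𝓘(ℝ, EM).prod 𝓘(ℝ, P₀)) 𝓘(ℝ, EM)
      (TotalSpace.proj : TotalSpace P₀ P → M) (s u.proj) :=
    ((Bundle.contMDiff_proj (n := ∞) P).contMDiffAt).mdifferentiableAt (by simp)
  have hev : (TotalSpace.proj ∘ s) =ᶠ[𝓝 u.proj] id := by
    filter_upwards [e.open_baseSet.mem_nhds hu] with x hx
    exact e.proj_symm_apply' hx
  have hc := mfderiv_comp u.proj hπ hs
  have hi := hev.mfderiv_eq (I := 𝓘(ℝ, EM)) (I' := 𝓘(ℝ, EM))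
  have H : Function.Surjective (mfderiv (𝓘(ℝ, EM).prod 𝓘(ℝ, P₀)) 𝓘(ℝ, EM)
      (TotalSpace.proj : TotalSpace P₀ P → M) (s u.proj)) := by
    intro w
    refine ⟨mfderiv 𝓘(ℝ, EM) (𝓘(ℝ, EM).prod 𝓘(ℝ, P₀)) s u.proj w, ?_⟩
    have h3 := congrArg (fun L ↦ L w) (hc.symm.trans hi)
    rw [mfderiv_id] at h3
    exact h3
  rwa [hsu] at H

theorem exists_horizontal {A : GenLieAlgebroid F₀ F h η} (C : Connection P₀ P A)
    (u : TotalSpace P₀ P) (z : F (h u.proj)) : ∃ ξ : Fib A u, ξ ∈ Horiz C u ∧ ξ.1.1 = z := by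
  obtain ⟨w, hw⟩ := proj_surjective u (A.anchorAt u.proj z)
  let ξ : Fib A u := ⟨(z, w), hw⟩
  refine ⟨ξ - (C.Γ u ξ : Fib A u), ?_, ?_⟩
  · simp [Horiz, C.split]
  · have h1 : ((C.Γ u ξ : Vert A u) : Fib A u).1.1 = 0 := (C.Γ u ξ).2
    simp [ξ, h1]

/-- The horizontal lift of `z`: the (unique) horizontal `(z, w)`. -/
def horLift {A : GenLieAlgebroid F₀ F h η} (C : Connection P₀ P A)
    (u : TotalSpace P₀ P) (z : F (h u.proj)) : Fib A u :=
  (exists_horizontal C u z).choose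

/-- The tangent vector at `u` of the curve `t ↦ u + t e` in the fibre through `u`. -/
def vertVec (u : TotalSpace P₀ P) (e : P u.proj) :
    TangentSpace (𝓘(ℝ, EM).prod 𝓘(ℝ, P₀)) u :=
  transport (𝓘(ℝ, EM).prod 𝓘(ℝ, P₀))
    (show (⟨u.proj, u.2 + (0 : ℝ) • e⟩ : TotalSpace P₀ P) = u by simp)
    (mfderiv 𝓘(ℝ, ℝ) (𝓘(ℝ, EM).prod 𝓘(ℝ, P₀))
      (fun t : ℝ ↦ (⟨u.proj, u.2 + t • e⟩ : TotalSpace P₀ P)) 0 (1 : ℝ))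

theorem mdifferentiable_fibreLine (u : TotalSpace P₀ P) (e : P u.proj) :
    MDifferentiableAt 𝓘(ℝ, ℝ) (𝓘(ℝ, EM).prod 𝓘(ℝ, P₀))
      (fun t : ℝ ↦ (⟨u.proj, u.2 + t • e⟩ : TotalSpace P₀ P)) 0 := by
  refine ContMDiffAt.mdifferentiableAt (n := ∞) ?_ (by simp)
  rw [contMDiffAt_totalSpace]
  refine ⟨contMDiffAt_const, ?_⟩
  have hu : u.proj ∈ (trivializationAt P₀ P u.proj).baseSet :=
    mem_baseSet_trivializationAt P₀ P u.proj
  have h1 : (fun t : ℝ ↦ ((trivializationAt P₀ P u.proj)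
      (⟨u.proj, u.2 + t • e⟩ : TotalSpace P₀ P)).2) =
      fun t : ℝ ↦ (trivializationAt P₀ P u.proj).linearMapAt ℝ u.proj u.2
        + t • (trivializationAt P₀ P u.proj).linearMapAt ℝ u.proj e := by
    funext t
    rw [← map_smul, ← map_add, Trivialization.linearMapAt_apply, if_pos hu]
  simp only [h1]
  exact (contDiff_const.add (contDiff_id.smul contDiff_const)).contMDiff.contMDiffAt

theorem proj_vertVec (u : TotalSpace P₀ P) (e : P u.proj) :
    mfderiv (𝓘(ℝ, EM).prod 𝓘(ℝ, P₀)) 𝓘(ℝ, EM) (TotalSpace.proj : TotalSpace P₀ P → M) u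
      (vertVec (EM := EM) u e) = 0 := by
  have hπ : MDifferentiableAt (𝓘(ℝ, EM).prod 𝓘(ℝ, P₀)) 𝓘(ℝ, EM)
      (TotalSpace.proj : TotalSpace P₀ P → M) ⟨u.proj, u.2 + (0 : ℝ) • e⟩ :=
    ((Bundle.contMDiff_proj (n := ∞) P).contMDiffAt).mdifferentiableAt (by simp)
  have hc := mfderiv_comp (0 : ℝ) hπ (mdifferentiable_fibreLine (EM := EM) u e)
  have h0 : (TotalSpace.proj : TotalSpace P₀ P → M) ∘
      (fun t : ℝ ↦ (⟨u.proj, u.2 + t • e⟩ : TotalSpace P₀ P)) = fun _ ↦ u.proj := rfl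
  rw [h0, mfderiv_const] at hc
  rw [vertVec, mfderiv_transport]
  have h3 := congrArg (fun L ↦ L (1 : ℝ)) hc
  refine (congrArg _ h3.symm).trans (map_zero _)

/-- The vertical vector `(0, vertVec u e)`; for `e = e^a` this is the section `∂/∂p_a`. -/
def vertLift (A : GenLieAlgebroid F₀ F h η) (u : TotalSpace P₀ P) (e : P u.proj) : Fib A u :=
  ⟨(0, vertVec u e), by simp [Fib, proj_vertVec]⟩

/-- A distinguished linear `(ρ, η)`-connection: a covariant derivative
`(X, σ) ↦ D_X σ` on sections of the generalized tangent bundle which preserves the horizontal and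
the vertical subbundle.  As for Mathlib's `CovariantDerivative`, linearity of `D_X σ` over functions
in `X` is expressed by letting `D σ u` be a linear map of the value of `X` at `u`, and the axioms
concern sections which are smooth on an open set. -/
structure DConnection {A : GenLieAlgebroid F₀ F h η} (C : Connection P₀ P A) where
  D : (∀ u : TotalSpace P₀ P, Fib A u) → ∀ u : TotalSpace P₀ P, Fib A u →ₗ[ℝ] Fib A u
  add : ∀ O, IsOpen O → ∀ σ τ, SmoothSec A O σ → SmoothSec A O τ → ∀ u ∈ O, ∀ ξ : Fib A u,
    D (fun v ↦ σ v + τ v) u ξ = D σ u ξ + D τ u ξ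
  leibniz : ∀ O, IsOpen O → ∀ (f : TotalSpace P₀ P → ℝ) σ,
    ContMDiffOn (𝓘(ℝ, EM).prod 𝓘(ℝ, P₀)) 𝓘(ℝ, ℝ) ∞ f O → SmoothSec A O σ →
    ∀ u ∈ O, ∀ ξ : Fib A u, D (fun v ↦ f v • σ v) u ξ = f u • D σ u ξ + deriv A f ξ • σ u
  smooth : ∀ O, IsOpen O → ∀ X σ, SmoothSec A O X → SmoothSec A O σ →
    SmoothSec A O (fun u ↦ D σ u (X u))
  horizontal : ∀ O, IsOpen O → ∀ σ, SmoothSec A O σ → (∀ u ∈ O, σ u ∈ Horiz C u) →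
    ∀ u ∈ O, ∀ ξ : Fib A u, D σ u ξ ∈ Horiz C u
  vertical : ∀ O, IsOpen O → ∀ σ, SmoothSec A O σ → (∀ u ∈ O, σ u ∈ Vert A u) →
    ∀ u ∈ O, ∀ ξ : Fib A u, D σ u ξ ∈ Vert A u

/-- A pseudometrical structure `G = g_{αβ} dz^α ⊗ dz^β + g^{ab} δp_a ⊗ δp_b`: a smooth symmetric
bilinear form on the generalized tangent bundle without mixed components, nondegenerate on the
horizontal and on the vertical subbundle.  (A metrical structure is a pseudometrical structure whose
two blocks have constant signature.) -/
structure PseudoMetric {A : GenLieAlgebroid F₀ F h η} (C : Connection P₀ P A) where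
  G : ∀ u : TotalSpace P₀ P, Fib A u →ₗ[ℝ] Fib A u →ₗ[ℝ] ℝ
  smooth : ∀ O, IsOpen O → ∀ σ τ, SmoothSec A O σ → SmoothSec A O τ →
    ContMDiffOn (𝓘(ℝ, EM).prod 𝓘(ℝ, P₀)) 𝓘(ℝ, ℝ) ∞ (fun u ↦ G u (σ u) (τ u)) O
  symm : ∀ u ξ ζ, G u ξ ζ = G u ζ ξ
  mixed : ∀ u, ∀ ξ ∈ Horiz C u, ∀ ζ ∈ Vert A u, G u ξ ζ = 0
  nondeg_horizontal : ∀ u, ∀ ξ ∈ Horiz C u, (∀ ζ ∈ Horiz C u, G u ξ ζ = 0) → ξ = 0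
  nondeg_vertical : ∀ u, ∀ ξ ∈ Vert A u, (∀ ζ ∈ Vert A u, G u ξ ζ = 0) → ξ = 0

/-- `D_X G = 0` for all `X`, where
`(D_X G)(σ, τ) = X (G(σ, τ)) - G(D_X σ, τ) - G(σ, D_X τ)`. -/
def IsParallel {A : GenLieAlgebroid F₀ F h η} {C : Connection P₀ P A} (Δ : DConnection C)
    (g : PseudoMetric C) : Prop :=
  ∀ O : Set (TotalSpace P₀ P), IsOpen O → ∀ σ τ : (∀ u : TotalSpace P₀ P, Fib A u),
    SmoothSec A O σ → SmoothSec A O τ → ∀ u ∈ O, ∀ ξ : Fib A u,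
      deriv A (fun v ↦ g.G v (σ v) (τ v)) ξ - g.G u (Δ.D σ u ξ) (τ u) - g.G u (σ u) (Δ.D τ u ξ) = 0

variable {p r : ℕ}

/-- The section `δ_α` of the adapted base: the horizontal lift of `t_α`. -/
def adaptedH {A : GenLieAlgebroid F₀ F h η} (C : Connection P₀ P A) (t : Fin p → ∀ y, F y)
    (α : Fin p) (u : TotalSpace P₀ P) : Fib A u :=
  horLift C u (t α (h u.proj))

/-- The section `∂^a = ∂/∂p_a` of the adapted base. -/
def adaptedV (A : GenLieAlgebroid F₀ F h η) (e : Fin r → ∀ x, P x) (a : Fin r)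
    (u : TotalSpace P₀ P) : Fib A u :=
  vertLift A u (e a u.proj)

/-- Four families of local functions, to serve as components of a distinguished linear
connection.  The order of the arguments is `H α β γ = H^α_{βγ}`, `H' a b γ = H^a_{bγ}`,
`V α β c = V^{αc}_β`, `V' a b c = V^{ac}_b`. -/
structure Components (Q : Type*) (p r : ℕ) where
  H : Fin p → Fin p → Fin p → Q → ℝ
  H' : Fin r → Fin r → Fin p → Q → ℝ
  V : Fin p → Fin p → Fin r → Q → ℝ
  V' : Fin r → Fin r → Fin r → Q → ℝ

/-- `K` gives, over the points `u` with `π u ∈ U` and `h (π u) ∈ W`, the components of the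
distinguished linear connection `Δ` in the adapted base of the local frames `e` and `t`:
`D_{δ_γ} δ_β = H^α_{βγ} δ_α`, `D_{δ_γ} ∂^a = H^a_{bγ} ∂^b`,
`D_{∂^c} δ_β = V^{αc}_β δ_α`, `D_{∂^c} ∂^a = V^{ac}_b ∂^b`. -/
def IsComponents {A : GenLieAlgebroid F₀ F h η} {C : Connection P₀ P A} (Δ : DConnection C)
    (U : Set M) (e : Fin r → ∀ x, P x) (W : Set N) (t : Fin p → ∀ y, F y)
    (K : Components (TotalSpace P₀ P) p r) : Prop :=
  ∀ u : TotalSpace P₀ P, u.proj ∈ U → h u.proj ∈ W →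
    (∀ β γ, Δ.D (adaptedH C t β) u (adaptedH C t γ u) = ∑ α, K.H α β γ u • adaptedH C t α u) ∧
    (∀ a γ, Δ.D (adaptedV A e a) u (adaptedH C t γ u) = ∑ b, K.H' a b γ u • adaptedV A e b u) ∧
    (∀ β c, Δ.D (adaptedH C t β) u (adaptedV A e c u) = ∑ α, K.V α β c u • adaptedH C t α u) ∧
    (∀ a c, Δ.D (adaptedV A e a) u (adaptedV A e c u) = ∑ b, K.V' a b c u • adaptedV A e b u)

/-- The matrix `g_{αβ} = G(δ_α, δ_β)`. -/
def gH {A : GenLieAlgebroid F₀ F h η} {C : Connection P₀ P A} (g : PseudoMetric C)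
    (t : Fin p → ∀ y, F y) (u : TotalSpace P₀ P) : Matrix (Fin p) (Fin p) ℝ :=
  Matrix.of fun α β ↦ g.G u (adaptedH C t α u) (adaptedH C t β u)

/-- The matrix `g^{ab} = G(∂^a, ∂^b)`. -/
def gV {A : GenLieAlgebroid F₀ F h η} {C : Connection P₀ P A} (g : PseudoMetric C)
    (e : Fin r → ∀ x, P x) (u : TotalSpace P₀ P) : Matrix (Fin r) (Fin r) ℝ :=
  Matrix.of fun a b ↦ g.G u (adaptedV A e a u) (adaptedV A e b u)

section CovariantComponents

variable {A : GenLieAlgebroid F₀ F h η} {C : Connection P₀ P A} (g : PseudoMetric C)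
  (e : Fin r → ∀ x, P x) (t : Fin p → ∀ y, F y) (K : Components (TotalSpace P₀ P) p r)
  (u : TotalSpace P₀ P)

/-- `g_{εβ|γ}`: the horizontal covariant derivative of `g_{εβ}` formed with the components `K`. -/
def covHH (ε β γ : Fin p) : ℝ :=
  deriv A (fun v ↦ gH g t v ε β) (adaptedH C t γ u)
    - ∑ θ, K.H θ ε γ u * gH g t u θ β - ∑ θ, K.H θ β γ u * gH g t u ε θ

/-- `g^{ea}_{|γ}`: the horizontal covariant derivative of `g^{ea}` formed with `K`. -/
def covVH (i a : Fin r) (γ : Fin p) : ℝ :=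
  deriv A (fun v ↦ gV g e v i a) (adaptedH C t γ u)
    - ∑ d, K.H' i d γ u * gV g e u d a - ∑ d, K.H' a d γ u * gV g e u i d

/-- `g_{εβ}|^c`: the vertical covariant derivative of `g_{εβ}` formed with `K`. -/
def covHV (ε β : Fin p) (c : Fin r) : ℝ :=
  deriv A (fun v ↦ gH g t v ε β) (adaptedV A e c u)
    - ∑ θ, K.V θ ε c u * gH g t u θ β - ∑ θ, K.V θ β c u * gH g t u ε θ

/-- `g^{ea}|^c`: the vertical covariant derivative of `g^{ea}` formed with `K`. -/
def covVV (i a c : Fin r) : ℝ :=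
  deriv A (fun v ↦ gV g e v i a) (adaptedV A e c u)
    - ∑ d, K.V' i d c u * gV g e u d a - ∑ d, K.V' a d c u * gV g e u i d

end CovariantComponents

/-- The corrected components:
`H^α_{βγ} + ½ g̃^{αε} g_{εβ|γ}`, `H^a_{bγ} + ½ g̃_{be} g^{ea}_{|γ}`,
`V^{αc}_β + ½ g̃^{αε} g_{εβ}|^c`, `V^{ac}_b + ½ g̃_{be} g^{ea}|^c`,
where `g̃` denotes the inverse matrices and the covariant derivatives are formed with `K`. -/
def corrected {A : GenLieAlgebroid F₀ F h η} {C : Connection P₀ P A} (g : PseudoMetric C)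
    (e : Fin r → ∀ x, P x) (t : Fin p → ∀ y, F y) (K : Components (TotalSpace P₀ P) p r) :
    Components (TotalSpace P₀ P) p r where
  H α β γ u := K.H α β γ u + 1 / 2 * ∑ ε, (gH g t u)⁻¹ α ε * covHH g t K u ε β γ
  H' a b γ u := K.H' a b γ u + 1 / 2 * ∑ i, (gV g e u)⁻¹ b i * covVH g e t K u i a γ
  V α β c u := K.V α β c u + 1 / 2 * ∑ ε, (gH g t u)⁻¹ α ε * covHV g e t K u ε β c
  V' a b c u := K.V' a b c u + 1 / 2 * ∑ i, (gV g e u)⁻¹ b i * covVV g e K u i a c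

end GeneralizedTangentBundle

end

end GenTangent

/-!
For a distinguished connection `Δ` let `Δ*` be its metric adjoint, determined by
`G(Δ*_X σ, τ) = X (G(σ, τ)) - G(σ, Δ_X τ)`.  The right-hand side is linear in `τ` over the smooth
functions, and `G` is nondegenerate, so this defines `Δ*`, and `Δ*` is again a distinguished
connection: it preserves the horizontal and the vertical subbundle because they are orthogonal
complements of each other and `Δ` preserves them.  The average `½ (Δ + Δ*)` satisfies
`G(D_X σ, τ) + G(σ, D_X τ) = X (G(σ, τ))`, that is `D G = 0` (`isParallel_metrization`), and since
`Δ*_X σ - Δ_X σ` is dual to `(Δ_X G)(σ, ·)`, its components are those of `Δ` plus half of the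
inverse matrix of `G` applied to the covariant derivative of `G` (`isComponents_metrization`).

The analytic content is the existence of smooth local frames of the generalized tangent bundle
(`isSmoothFrame_adapted`).  They make the adjoint definable at a point, let its defining identity
pass from frame members to all smooth sections (`IsSmoothFrame.pairing`), and turn smooth pairings
into smooth sections (`IsSmoothFrame.smoothSec`).  The vertical members are tangent maps of
translations along the fibres (`smoothSec_vertLift`).  The horizontal members need a smooth lift of
the anchor vector field (`smoothSec_horLift`), and so its smoothness across the boundary of the set
where `η ∘ h` has fixed points; this is where the algebroid axioms enter, through the vanishing of
the anchor off the fixed points of `h ∘ η` (`GenLieAlgebroid.ρ_eq_zero`).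

A connection acts on sections that are defined everywhere but smooth only on an open set.  Its
locality needs no bump functions (`DConnection.congr`): the indicator function of an open set is
smooth on that set.
-/

namespace GenTangent

noncomputable section

/-! ### Tangent vectors and directional derivatives -/

section Transport

variable {EM : Type*} [NormedAddCommGroup EM] [NormedSpace ℝ EM]
    {HM : Type*} [TopologicalSpace HM] (I : ModelWithCorners ℝ EM HM)
    {M : Type*} [TopologicalSpace M] [ChartedSpace HM M]

theorem mk_transport {x y : M} (hxy : x = y) (v : TangentSpace I x) :
    (⟨y, transport I hxy v⟩ : TangentBundle I M) = ⟨x, v⟩ := by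
  subst hxy
  rfl

theorem transport_injective {x y : M} (hxy : x = y) :
    Function.Injective (transport I hxy) := by
  subst hxy
  exact fun _ _ h ↦ h

theorem dirDeriv_congr {f f' : M → ℝ} {x : M} (hf : f =ᶠ[𝓝 x] f') (v : TangentSpace I x) :
    dirDeriv I f v = dirDeriv I f' v := by
  unfold dirDeriv
  have := hf.mfderiv_eq (I := I) (I' := 𝓘(ℝ, ℝ))
  exact congrArg (fun L : TangentSpace I x →L[ℝ] ℝ ↦ L v) this

theorem dirDeriv_const (c : ℝ) {x : M} (v : TangentSpace I x) :
    dirDeriv I (fun _ ↦ c) v = 0 := by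
  unfold dirDeriv
  rw [mfderiv_const]
  rfl

end Transport

/-! ### Global smooth sections and functions with prescribed local data -/

section Globalization

variable {EM : Type*} [NormedAddCommGroup EM] [NormedSpace ℝ EM] [FiniteDimensional ℝ EM]
  {N : Type*} [TopologicalSpace N] [T2Space N] [ChartedSpace EM N] [IsManifold 𝓘(ℝ, EM) ∞ N]
  {F₀ : Type*} [NormedAddCommGroup F₀] [NormedSpace ℝ F₀]
  {F : N → Type*} [TopologicalSpace (TotalSpace F₀ F)]
  [∀ y, AddCommGroup (F y)] [∀ y, Module ℝ (F y)] [∀ y, TopologicalSpace (F y)]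
  [FiberBundle F₀ F] [VectorBundle ℝ F₀ F] [ContMDiffVectorBundle ∞ F₀ F 𝓘(ℝ, EM)]

theorem exists_smoothSection_apply_eq (y : N) (v : F y) :
    ∃ s : Cₛ^∞⟮𝓘(ℝ, EM); F₀, F⟯, s y = v := by
  obtain ⟨O, hO, hs⟩ := FiberBundle.exists_contMDiffOn_extend (k := ∞) 𝓘(ℝ, EM) F₀ v
  obtain ⟨O', hO', hO'o, hy⟩ := mem_nhds_iff.1 hO
  obtain ⟨ψ, -, hψ⟩ := (SmoothBumpFunction.nhds_basis_tsupport (I := 𝓘(ℝ, EM)) y).mem_iff.1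
    (hO'o.mem_nhds hy)
  refine ⟨⟨_, ContMDiffOn.smul_section_of_tsupport (n := ∞) ψ.contMDiff.contMDiffOn hO'o hψ
    (hs.mono hO')⟩, ?_⟩
  change ψ y • FiberBundle.extend F₀ v y = v
  simp

theorem exists_smooth_eq_one_eventuallyEq_zero {x y : N} (hxy : x ≠ y) :
    ∃ f : N → ℝ, ContMDiff 𝓘(ℝ, EM) 𝓘(ℝ, ℝ) ∞ f ∧ f x = 1 ∧ f =ᶠ[𝓝 y] fun _ ↦ 0 := by
  obtain ⟨ψ, -, hψ⟩ := (SmoothBumpFunction.nhds_basis_tsupport (I := 𝓘(ℝ, EM)) x).mem_iff.1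
    (isOpen_compl_singleton.mem_nhds (show x ∈ ({y}ᶜ : Set N) from hxy))
  refine ⟨ψ, ψ.contMDiff, by simp, ?_⟩
  filter_upwards [(isClosed_tsupport ψ).isOpen_compl.mem_nhds (fun h ↦ hψ h rfl)] with z hz
  exact image_eq_zero_of_notMem_tsupport hz

/-- Globally defined smooth functions separate tangent vectors: a linear form composed with a
chart, multiplied by a bump function, is one. -/
theorem eq_zero_of_dirDeriv_eq_zero {y : N} (w : TangentSpace 𝓘(ℝ, EM) y)
    (hw : ∀ f : N → ℝ, ContMDiff 𝓘(ℝ, EM) 𝓘(ℝ, ℝ) ∞ f → dirDeriv 𝓘(ℝ, EM) f w = 0) :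
    w = 0 := by
  have hinv := isInvertible_mfderiv_extChartAt (I := 𝓘(ℝ, EM)) (mem_extChartAt_source y)
  have hφ : MDifferentiableAt 𝓘(ℝ, EM) 𝓘(ℝ, EM) (extChartAt 𝓘(ℝ, EM) y) y :=
    mdifferentiableAt_extChartAt (mem_chart_source _ y)
  obtain ⟨L, hL⟩ := hinv
  apply L.injective
  rw [map_zero]
  refine (congrArg (fun T : TangentSpace 𝓘(ℝ, EM) y →L[ℝ] EM ↦ T w) hL).trans ?_
  refine SeparatingDual.eq_zero_of_forall_dual_eq_zero (R := ℝ) (V := EM) fun ℓ ↦ ?_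
  let ψ : SmoothBumpFunction 𝓘(ℝ, EM) y := Classical.arbitrary _
  have hg : ContMDiffOn 𝓘(ℝ, EM) 𝓘(ℝ, ℝ) ∞ (fun z ↦ ℓ (extChartAt 𝓘(ℝ, EM) y z))
      (chartAt EM y).source :=
    ℓ.contDiff.contMDiff.comp_contMDiffOn contMDiffOn_extChartAt
  have h1 := hw _ (ψ.contMDiff_smul hg)
  rw [dirDeriv_congr (f' := ℓ ∘ extChartAt 𝓘(ℝ, EM) y)] at h1
  · have hc := mfderiv_comp y (I := 𝓘(ℝ, EM)) (I' := 𝓘(ℝ, EM)) (I'' := 𝓘(ℝ, ℝ))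
      (g := ℓ) (f := extChartAt 𝓘(ℝ, EM) y) ℓ.differentiableAt.mdifferentiableAt hφ
    unfold dirDeriv at h1
    rw [hc, mfderiv_eq_fderiv, ℓ.fderiv] at h1
    exact h1
  · filter_upwards [ψ.eventuallyEq_one] with z hz
    simp [hz]

end Globalization

/-! ### The anchor of a generalized Lie algebroid -/

section Anchor

variable {EM : Type*} [NormedAddCommGroup EM] [NormedSpace ℝ EM] [FiniteDimensional ℝ EM]
  {M : Type*} [TopologicalSpace M] [ChartedSpace EM M] [IsManifold 𝓘(ℝ, EM) ∞ M]
  {N : Type*} [TopologicalSpace N] [T2Space N] [ChartedSpace EM N] [IsManifold 𝓘(ℝ, EM) ∞ N]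
  {F₀ : Type*} [NormedAddCommGroup F₀] [NormedSpace ℝ F₀]
  {F : N → Type*} [TopologicalSpace (TotalSpace F₀ F)]
  [∀ y, AddCommGroup (F y)] [∀ y, Module ℝ (F y)] [∀ y, TopologicalSpace (F y)]
  [FiberBundle F₀ F] [VectorBundle ℝ F₀ F] [ContMDiffVectorBundle ∞ F₀ F 𝓘(ℝ, EM)]
  {h : M ≃ₘ^∞⟮𝓘(ℝ, EM), 𝓘(ℝ, EM)⟯ N} {η : N ≃ₘ^∞⟮𝓘(ℝ, EM), 𝓘(ℝ, EM)⟯ M}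

theorem GenLieAlgebroid.bracket_neg_swap (A : GenLieAlgebroid F₀ F h η)
    (u v : Cₛ^∞⟮𝓘(ℝ, EM); F₀, F⟯) : A.bracket u v = -A.bracket v u := by
  have h1 := A.bracket_self (u + v)
  rw [A.bracket_add_left, A.bracket_add_right, A.bracket_add_right, A.bracket_self,
    A.bracket_self, zero_add, add_zero] at h1
  exact eq_neg_of_add_eq_zero_left h1

theorem GenLieAlgebroid.anchorField_smul (A : GenLieAlgebroid F₀ F h η) (f : N → ℝ)
    (u : ∀ y, F y) (y : N) :
    anchorField h η A.ρ (fun y ↦ f y • u y) y =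
      f (η.symm (h.symm y)) • anchorField h η A.ρ u y := by
  simp only [anchorField, map_smul]

theorem GenLieAlgebroid.apply_eq_zero_of_anchorField_eq_zero (A : GenLieAlgebroid F₀ F h η)
    (u : ∀ y, F y) (y : N) (hu : anchorField h η A.ρ u y = 0) :
    A.ρ (η.symm (h.symm y)) (u (η.symm (h.symm y))) = 0 := by
  unfold anchorField at hu
  have h1 := transport_injective 𝓘(ℝ, EM) _ (hu.trans (map_zero _).symm)
  have h2 := (h.mfderivToContinuousLinearEquiv (by simp)
    (η (η.symm (h.symm y)))).injective
  exact h2 (h1.trans (map_zero _).symm)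

/-- The axioms force the anchor to vanish off the fixed points of `h ∘ η`.  For `y = h (η k) ≠ k`,
take `f` equal to `1` at `k` and to `0` near `y`.  Then `θ(f u)` at `y` is `f(k) θ(u) = θ(u)`,
whereas all brackets with `f u` vanish at `y`; the Leibniz rule for `[f u, g v]` at `y` leaves
`θ(u)(g) v = 0` for all `g` and `v`. -/
theorem GenLieAlgebroid.ρ_eq_zero (A : GenLieAlgebroid F₀ F h η) {k : N} (hk : h (η k) ≠ k) :
    A.ρ k = 0 := by
  obtain ⟨y, rfl⟩ : ∃ y, k = η.symm (h.symm y) := ⟨h (η k), by simp⟩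
  have hky : η.symm (h.symm y) ≠ y := by simpa using hk.symm
  ext z
  rcases subsingleton_or_nontrivial F₀ with hF | hF
  · have e := (trivializationAt F₀ F (η.symm (h.symm y))).continuousLinearEquivAt ℝ _
      (mem_baseSet_trivializationAt F₀ F _)
    have : z = 0 := e.injective (Subsingleton.elim _ _)
    simp [this]
  obtain ⟨u, rfl⟩ := exists_smoothSection_apply_eq (EM := EM) (F₀ := F₀) _ z
  refine A.apply_eq_zero_of_anchorField_eq_zero u y ?_
  obtain ⟨c, hc⟩ := exists_ne (0 : F₀)
  let e := (trivializationAt F₀ F y).continuousLinearEquivAt ℝ y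
    (mem_baseSet_trivializationAt F₀ F y)
  obtain ⟨v, hv⟩ := exists_smoothSection_apply_eq (EM := EM) (F₀ := F₀) y (e.symm c)
  have hv0 : v y ≠ 0 := by
    rw [hv]
    simpa using hc
  obtain ⟨f, hf, hf1, hf0⟩ := exists_smooth_eq_one_eventuallyEq_zero (EM := EM) hky
  refine eq_zero_of_dirDeriv_eq_zero _ fun g hg ↦ ?_
  let fu : Cₛ^∞⟮𝓘(ℝ, EM); F₀, F⟯ := ⟨fun y ↦ f y • u y, hf.smul_section u.contMDiff⟩
  let gv : Cₛ^∞⟮𝓘(ℝ, EM); F₀, F⟯ := ⟨fun y ↦ g y • v y, hg.smul_section v.contMDiff⟩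
  have hfy : f y = 0 := hf0.eq_of_nhds
  have hfd (w : TangentSpace 𝓘(ℝ, EM) y) : dirDeriv 𝓘(ℝ, EM) f w = 0 := by
    rw [dirDeriv_congr _ hf0, dirDeriv_const]
  -- a bracket `[w, f u]` vanishes at `y`, because `f` vanishes near `y`
  have hvan (w : Cₛ^∞⟮𝓘(ℝ, EM); F₀, F⟯) : A.bracket w fu y = 0 := by
    rw [A.leibniz w u fu f hf (fun _ ↦ rfl) y, hfy, hfd, zero_smul, zero_smul, add_zero]
  have hvan' (w : Cₛ^∞⟮𝓘(ℝ, EM); F₀, F⟯) : A.bracket fu w y = 0 := by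
    rw [A.bracket_neg_swap]
    change -(A.bracket w fu y) = 0
    rw [hvan, neg_zero]
  have h1 := A.leibniz fu v gv g hg (fun _ ↦ rfl) y
  rw [hvan', hvan', smul_zero, zero_add] at h1
  have h2 : anchorField h η A.ρ fu y = anchorField h η A.ρ u y := by
    have := A.anchorField_smul f u y
    rw [hf1, one_smul] at this
    exact this
  rw [h2] at h1
  exact (smul_eq_zero.1 h1.symm).resolve_right hv0

/-- The anchor along `h` maps smooth sections of `h^* F` to smooth vector fields.  At a fixed point
of `η ∘ h` this rests on the vanishing of `ρ` off the fixed points of `h ∘ η`: in a chart, the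
coordinates of the case-defined anchor agree with those of `ρ`. -/
theorem GenLieAlgebroid.contMDiffAt_anchorAt [T2Space M] (A : GenLieAlgebroid F₀ F h η)
    (z : ∀ x, F (h x)) (x₀ : M)
    (hz : ContMDiffAt 𝓘(ℝ, EM) (𝓘(ℝ, EM).prod 𝓘(ℝ, F₀)) ∞
      (fun x ↦ (⟨h x, z x⟩ : TotalSpace F₀ F)) x₀) :
    ContMDiffAt 𝓘(ℝ, EM) 𝓘(ℝ, EM).tangent ∞
      (fun x ↦ (⟨x, A.anchorAt x (z x)⟩ : TangentBundle 𝓘(ℝ, EM) M)) x₀ := by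
  have hηh : Continuous fun x ↦ η (h x) := η.continuous.comp h.continuous
  by_cases hx₀ : η (h x₀) = x₀
  · have h1 : ContMDiffAt 𝓘(ℝ, EM) 𝓘(ℝ, EM).tangent ∞
        (fun x ↦ (⟨η (h x), A.ρ (h x) (z x)⟩ : TangentBundle 𝓘(ℝ, EM) M)) x₀ :=
      A.ρ_smooth.contMDiffAt.comp x₀ hz
    have h2 := (contMDiffAt_totalSpace.1 h1).2
    dsimp only at h2
    rw [hx₀] at h2
    refine contMDiffAt_section _ |>.2 (h2.congr_of_eventuallyEq ?_)
    set e := trivializationAt EM (TangentSpace 𝓘(ℝ, EM) : M → Type _) x₀ with he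
    have hb : x₀ ∈ e.baseSet := mem_baseSet_trivializationAt EM (TangentSpace 𝓘(ℝ, EM)) x₀
    have hn1 : ∀ᶠ x in 𝓝 x₀, x ∈ e.baseSet := e.open_baseSet.mem_nhds hb
    have hn2 : ∀ᶠ x in 𝓝 x₀, η (h x) ∈ e.baseSet :=
      hηh.continuousAt.eventually (e.open_baseSet.mem_nhds (by simpa only [hx₀] using hb))
    filter_upwards [hn1, hn2] with x hx1 hx2
    by_cases hx : η (h x) = x
    · have : (⟨x, A.anchorAt x (z x)⟩ : TangentBundle 𝓘(ℝ, EM) M) =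
          ⟨η (h x), A.ρ (h x) (z x)⟩ := by
        rw [GenLieAlgebroid.anchorAt, dif_pos hx]
        exact mk_transport _ _ _
      exact congrArg (fun q ↦ (e q).2) this
    · have h3 : A.ρ (h x) = 0 := A.ρ_eq_zero fun h4 ↦ hx (h.injective h4)
      have h5 : A.anchorAt x = 0 := by rw [GenLieAlgebroid.anchorAt, dif_neg hx]
      rw [h3, h5]
      have a1 := congrArg Prod.snd (e.zeroSection ℝ hx1)
      have a2 := congrArg Prod.snd (e.zeroSection ℝ hx2)
      exact a1.trans a2.symm
  · have hn : ∀ᶠ x in 𝓝 x₀, η (h x) ≠ x :=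
      (isOpen_ne_fun hηh continuous_id).mem_nhds hx₀
    refine (contMDiff_zeroSection ℝ (F := EM) (TangentSpace 𝓘(ℝ, EM) : M → Type _)).contMDiffAt
      |>.congr_of_eventuallyEq ?_
    filter_upwards [hn] with x hx
    rw [GenLieAlgebroid.anchorAt, dif_neg hx]
    rfl

end Anchor

/-! ### Smoothness of tangent maps and of inverse matrices -/

section SmoothMaps

variable {E₁ : Type*} [NormedAddCommGroup E₁] [NormedSpace ℝ E₁]
  {H₁ : Type*} [TopologicalSpace H₁] {I₁ : ModelWithCorners ℝ E₁ H₁}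
  {Q : Type*} [TopologicalSpace Q] [ChartedSpace H₁ Q]
  {E₂ : Type*} [NormedAddCommGroup E₂] [NormedSpace ℝ E₂]
  {H₂ : Type*} [TopologicalSpace H₂] {I₂ : ModelWithCorners ℝ E₂ H₂}
  {N : Type*} [TopologicalSpace N] [ChartedSpace H₂ N]
  {E₃ : Type*} [NormedAddCommGroup E₃] [NormedSpace ℝ E₃]
  {H₃ : Type*} [TopologicalSpace H₃] {I₃ : ModelWithCorners ℝ E₃ H₃}
  {R : Type*} [TopologicalSpace R] [ChartedSpace H₃ R]

/-- Linear combinations of smooth sections of a vector bundle along a map `f` into its base. -/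
theorem contMDiffOn_smul_add_smul_along {F₀ : Type*} [NormedAddCommGroup F₀] [NormedSpace ℝ F₀]
    {F : N → Type*} [TopologicalSpace (TotalSpace F₀ F)]
    [∀ y, AddCommGroup (F y)] [∀ y, Module ℝ (F y)] [∀ y, TopologicalSpace (F y)]
    [FiberBundle F₀ F] [VectorBundle ℝ F₀ F] {n : ℕ∞ω}
    {O : Set Q} {f : Q → N} {z₁ z₂ : ∀ q, F (f q)} {c₁ c₂ : Q → ℝ}
    (hc₁ : ContMDiffOn I₁ 𝓘(ℝ, ℝ) n c₁ O) (hc₂ : ContMDiffOn I₁ 𝓘(ℝ, ℝ) n c₂ O)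
    (hz₁ : ContMDiffOn I₁ (I₂.prod 𝓘(ℝ, F₀)) n (fun q ↦ (⟨f q, z₁ q⟩ : TotalSpace F₀ F)) O)
    (hz₂ : ContMDiffOn I₁ (I₂.prod 𝓘(ℝ, F₀)) n (fun q ↦ (⟨f q, z₂ q⟩ : TotalSpace F₀ F)) O) :
    ContMDiffOn I₁ (I₂.prod 𝓘(ℝ, F₀)) n
      (fun q ↦ (⟨f q, c₁ q • z₁ q + c₂ q • z₂ q⟩ : TotalSpace F₀ F)) O := by
  intro q hq
  have h1 := contMDiffWithinAt_totalSpace.1 (hz₁ q hq)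
  have h2 := contMDiffWithinAt_totalSpace.1 (hz₂ q hq)
  refine contMDiffWithinAt_totalSpace.2 ⟨h1.1, ?_⟩
  refine (((hc₁ q hq).smul h1.2).add ((hc₂ q hq).smul h2.2)).congr_of_eventuallyEq_of_mem ?_ hq
  have hb := h1.1.continuousWithinAt.eventually
    ((trivializationAt F₀ F (f q)).open_baseSet.mem_nhds
      (mem_baseSet_trivializationAt F₀ F (f q)))
  filter_upwards [hb] with q' hq'
  have hlin := (trivializationAt F₀ F (f q)).linear ℝ hq'
  have h3 := hlin.map_add (c₁ q' • z₁ q') (c₂ q' • z₂ q')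
  have h4 := hlin.map_smul (c₁ q') (z₁ q')
  have h5 := hlin.map_smul (c₂ q') (z₂ q')
  rw [h3, h4, h5]
  rfl

/-- Tangent maps preserve smoothness of maps into the tangent bundle; local version. -/
theorem contMDiffOn_mfderiv_along [IsManifold I₂ ∞ N] [IsManifold I₃ ∞ R]
    {O : Set Q} {U : Set N} (hU : IsOpen U) {f : N → R} (hf : ContMDiffOn I₂ I₃ ∞ f U)
    {X : Q → TangentBundle I₂ N} (hX : ContMDiffOn I₁ I₂.tangent ∞ X O)
    (hXU : ∀ q ∈ O, (X q).proj ∈ U) :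
    ContMDiffOn I₁ I₃.tangent ∞ (fun q ↦ tangentMap I₂ I₃ f (X q)) O := by
  have h1 := hf.contMDiffOn_tangentMapWithin (m := ∞) (by simp) hU.uniqueMDiffOn
  refine (h1.comp hX hXU).congr fun q hq ↦ ?_
  rw [Function.comp_apply, tangentMapWithin_eq_tangentMap]
  · exact hU.uniqueMDiffOn _ (hXU q hq)
  · exact (hf.contMDiffAt (hU.mem_nhds (hXU q hq))).mdifferentiableAt (by simp)

theorem contMDiffOn_dirDeriv [IsManifold I₂ ∞ N]
    {O : Set N} (hO : IsOpen O) {f : N → ℝ} (hf : ContMDiffOn I₂ 𝓘(ℝ, ℝ) ∞ f O)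
    {w : ∀ q, TangentSpace I₂ q}
    (hw : ContMDiffOn I₂ I₂.tangent ∞ (fun q ↦ (⟨q, w q⟩ : TangentBundle I₂ N)) O) :
    ContMDiffOn I₂ 𝓘(ℝ, ℝ) ∞ (fun q ↦ dirDeriv I₂ f (w q)) O := by
  have h1 := contMDiffOn_mfderiv_along hO hf hw (fun q hq ↦ hq)
  exact (contMDiff_snd_tangentBundle_modelSpace ℝ 𝓘(ℝ, ℝ) (n := ∞)).comp_contMDiffOn h1

theorem contMDiffOn_det {ι : Type*} [Fintype ι] [DecidableEq ι] {O : Set Q}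
    {g : Q → Matrix ι ι ℝ} {n : ℕ∞ω}
    (hg : ∀ i j, ContMDiffOn I₁ 𝓘(ℝ, ℝ) n (fun q ↦ g q i j) O) :
    ContMDiffOn I₁ 𝓘(ℝ, ℝ) n (fun q ↦ (g q).det) O := by
  simp only [Matrix.det_apply']
  refine contMDiffOn_finsetSum fun σ _ ↦ contMDiffOn_const.mul ?_
  exact contMDiffOn_finsetProd fun i _ ↦ hg _ _

theorem contMDiffOn_matrix_inv {ι : Type*} [Fintype ι] [DecidableEq ι] {O : Set Q}
    {g : Q → Matrix ι ι ℝ} {n : ℕ∞ω}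
    (hg : ∀ i j, ContMDiffOn I₁ 𝓘(ℝ, ℝ) n (fun q ↦ g q i j) O)
    (hdet : ∀ q ∈ O, (g q).det ≠ 0) (i j : ι) :
    ContMDiffOn I₁ 𝓘(ℝ, ℝ) n (fun q ↦ (g q)⁻¹ i j) O := by
  simp only [Matrix.inv_def, Ring.inverse_eq_inv', Matrix.smul_apply, smul_eq_mul,
    Matrix.adjugate_apply]
  refine ((contMDiffOn_det hg).inv₀ hdet).mul (contMDiffOn_det fun k l ↦ ?_)
  by_cases hk : k = j
  · subst hk
    simpa only [Matrix.updateRow_self] using contMDiffOn_const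
  · simpa only [Matrix.updateRow_ne hk] using hg k l

end SmoothMaps

/-! ### Calculus of smooth sections of the generalized tangent bundle -/

section SmoothSections

variable {EM : Type*} [NormedAddCommGroup EM] [NormedSpace ℝ EM]
  {M : Type*} [TopologicalSpace M] [ChartedSpace EM M] [IsManifold 𝓘(ℝ, EM) ∞ M]
  {N : Type*} [TopologicalSpace N] [ChartedSpace EM N] [IsManifold 𝓘(ℝ, EM) ∞ N]
  {F₀ : Type*} [NormedAddCommGroup F₀] [NormedSpace ℝ F₀]
  {F : N → Type*} [TopologicalSpace (TotalSpace F₀ F)]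
  [∀ y, AddCommGroup (F y)] [∀ y, Module ℝ (F y)] [∀ y, TopologicalSpace (F y)]
  [FiberBundle F₀ F] [VectorBundle ℝ F₀ F] [ContMDiffVectorBundle ∞ F₀ F 𝓘(ℝ, EM)]
  {h : M ≃ₘ^∞⟮𝓘(ℝ, EM), 𝓘(ℝ, EM)⟯ N} {η : N ≃ₘ^∞⟮𝓘(ℝ, EM), 𝓘(ℝ, EM)⟯ M}
  {P₀ : Type*} [NormedAddCommGroup P₀] [NormedSpace ℝ P₀]
  {P : M → Type*} [TopologicalSpace (TotalSpace P₀ P)]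
  [∀ x, AddCommGroup (P x)] [∀ x, Module ℝ (P x)] [∀ x, TopologicalSpace (P x)]
  [FiberBundle P₀ P] [VectorBundle ℝ P₀ P] [ContMDiffVectorBundle ∞ P₀ P 𝓘(ℝ, EM)]
  {A : GenLieAlgebroid F₀ F h η} {O O' : Set (TotalSpace P₀ P)}
  {X Y : ∀ u : TotalSpace P₀ P, Fib A u}

theorem SmoothSec.mono (hX : SmoothSec A O X) (hO : O' ⊆ O) : SmoothSec A O' X :=
  ⟨hX.1.mono hO, hX.2.mono hO⟩

theorem SmoothSec.congr (hX : SmoothSec A O X) (hXY : ∀ u ∈ O, Y u = X u) : SmoothSec A O Y :=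
  ⟨hX.1.congr fun u hu ↦ by rw [hXY u hu], hX.2.congr fun u hu ↦ by rw [hXY u hu]⟩

theorem SmoothSec.of_locally
    (hX : ∀ u ∈ O, ∃ O', IsOpen O' ∧ u ∈ O' ∧ SmoothSec A (O ∩ O') X) : SmoothSec A O X := by
  constructor
  · refine contMDiffOn_of_locally_contMDiffOn fun u hu ↦ ?_
    obtain ⟨O', h1, h2, h3⟩ := hX u hu
    exact ⟨O', h1, h2, h3.1⟩
  · refine contMDiffOn_of_locally_contMDiffOn fun u hu ↦ ?_
    obtain ⟨O', h1, h2, h3⟩ := hX u hu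
    exact ⟨O', h1, h2, h3.2⟩

theorem SmoothSec.smul_add_smul {c₁ c₂ : TotalSpace P₀ P → ℝ}
    (hc₁ : ContMDiffOn (𝓘(ℝ, EM).prod 𝓘(ℝ, P₀)) 𝓘(ℝ, ℝ) ∞ c₁ O)
    (hc₂ : ContMDiffOn (𝓘(ℝ, EM).prod 𝓘(ℝ, P₀)) 𝓘(ℝ, ℝ) ∞ c₂ O)
    (hX : SmoothSec A O X) (hY : SmoothSec A O Y) :
    SmoothSec A O (fun u ↦ c₁ u • X u + c₂ u • Y u) :=
  ⟨contMDiffOn_smul_add_smul_along hc₁ hc₂ hX.1 hY.1,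
    contMDiffOn_smul_add_smul_along (f := id) hc₁ hc₂ hX.2 hY.2⟩

theorem SmoothSec.add (hX : SmoothSec A O X) (hY : SmoothSec A O Y) :
    SmoothSec A O (fun u ↦ X u + Y u) := by
  simpa only [one_smul] using
    hX.smul_add_smul (c₁ := fun _ ↦ 1) (c₂ := fun _ ↦ 1) contMDiffOn_const contMDiffOn_const hY

theorem SmoothSec.sub (hX : SmoothSec A O X) (hY : SmoothSec A O Y) :
    SmoothSec A O (fun u ↦ X u - Y u) :=
  (hX.smul_add_smul (c₁ := fun _ ↦ 1) (c₂ := fun _ ↦ -1)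
    contMDiffOn_const contMDiffOn_const hY).congr fun u _ ↦ by
      rw [one_smul, sub_eq_add_neg]; exact congrArg (X u + ·) (neg_one_smul ℝ (Y u)).symm

theorem SmoothSec.smul {c : TotalSpace P₀ P → ℝ}
    (hc : ContMDiffOn (𝓘(ℝ, EM).prod 𝓘(ℝ, P₀)) 𝓘(ℝ, ℝ) ∞ c O) (hX : SmoothSec A O X) :
    SmoothSec A O (fun u ↦ c u • X u) := by
  simpa only [zero_smul, add_zero] using
    hX.smul_add_smul hc (contMDiffOn_const (c := (0 : ℝ))) hX

theorem SmoothSec.zero : SmoothSec A O (fun _ ↦ 0) := by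
  constructor
  · exact ((contMDiff_zeroSection ℝ (F := F₀) F).comp
      (h.contMDiff.comp (contMDiff_proj P))).contMDiffOn
  · exact (contMDiff_zeroSection ℝ (F := EM × P₀)
      (TangentSpace (𝓘(ℝ, EM).prod 𝓘(ℝ, P₀)) : TotalSpace P₀ P → Type _)).contMDiffOn

theorem SmoothSec.sum {ι : Type*} (s : Finset ι) {Z : ι → ∀ u : TotalSpace P₀ P, Fib A u}
    (hZ : ∀ i ∈ s, SmoothSec A O (Z i)) : SmoothSec A O (fun u ↦ ∑ i ∈ s, Z i u) := by
  classical
  induction s using Finset.induction_on with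
  | empty => simpa using SmoothSec.zero
  | insert i s hi ih =>
    simp only [Finset.sum_insert hi]
    exact (hZ i (Finset.mem_insert_self i s)).add
      (ih fun j hj ↦ hZ j (Finset.mem_insert_of_mem hj))

theorem deriv_congr {f f' : TotalSpace P₀ P → ℝ} {u : TotalSpace P₀ P} (hf : f =ᶠ[𝓝 u] f')
    (ξ : Fib A u) : deriv A f ξ = deriv A f' ξ :=
  dirDeriv_congr _ hf _

theorem deriv_const (c : ℝ) {u : TotalSpace P₀ P} (ξ : Fib A u) : deriv A (fun _ ↦ c) ξ = 0 :=
  dirDeriv_const _ c _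

theorem deriv_add {f f' : TotalSpace P₀ P → ℝ} {u : TotalSpace P₀ P}
    (hf : MDifferentiableAt (𝓘(ℝ, EM).prod 𝓘(ℝ, P₀)) 𝓘(ℝ, ℝ) f u)
    (hf' : MDifferentiableAt (𝓘(ℝ, EM).prod 𝓘(ℝ, P₀)) 𝓘(ℝ, ℝ) f' u) (ξ : Fib A u) :
    deriv A (fun v ↦ f v + f' v) ξ = deriv A f ξ + deriv A f' ξ :=
  congrArg (fun T : TangentSpace (𝓘(ℝ, EM).prod 𝓘(ℝ, P₀)) u →L[ℝ] ℝ ↦ T ξ.1.2)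
    (mfderiv_add hf hf')

theorem deriv_mul {f f' : TotalSpace P₀ P → ℝ} {u : TotalSpace P₀ P}
    (hf : MDifferentiableAt (𝓘(ℝ, EM).prod 𝓘(ℝ, P₀)) 𝓘(ℝ, ℝ) f u)
    (hf' : MDifferentiableAt (𝓘(ℝ, EM).prod 𝓘(ℝ, P₀)) 𝓘(ℝ, ℝ) f' u) (ξ : Fib A u) :
    deriv A (fun v ↦ f v * f' v) ξ = f u * deriv A f' ξ + f' u * deriv A f ξ :=
  congrArg (fun T : TangentSpace (𝓘(ℝ, EM).prod 𝓘(ℝ, P₀)) u →L[ℝ] ℝ ↦ T ξ.1.2)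
    (hf.hasMFDerivAt.mul hf'.hasMFDerivAt).mfderiv

/-- The derivative of a fixed function at a point, as a linear form on the fibre. -/
def derivLinear (A : GenLieAlgebroid F₀ F h η) (f : TotalSpace P₀ P → ℝ) (u : TotalSpace P₀ P) :
    Fib A u →ₗ[ℝ] ℝ :=
  (mfderiv (𝓘(ℝ, EM).prod 𝓘(ℝ, P₀)) 𝓘(ℝ, ℝ) f u).toLinearMap.comp
    ((LinearMap.snd ℝ _ _).comp (Fib A u).subtype)

@[simp]
theorem derivLinear_apply (f : TotalSpace P₀ P → ℝ) (u : TotalSpace P₀ P) (ξ : Fib A u) :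
    derivLinear A f u ξ = deriv A f ξ :=
  rfl

theorem contMDiffOn_deriv {f : TotalSpace P₀ P → ℝ} (hO : IsOpen O)
    (hf : ContMDiffOn (𝓘(ℝ, EM).prod 𝓘(ℝ, P₀)) 𝓘(ℝ, ℝ) ∞ f O) (hX : SmoothSec A O X) :
    ContMDiffOn (𝓘(ℝ, EM).prod 𝓘(ℝ, P₀)) 𝓘(ℝ, ℝ) ∞ (fun u ↦ deriv A f (X u)) O :=
  contMDiffOn_dirDeriv hO hf hX.2

end SmoothSections

/-! ### Vertical and horizontal lifts -/

theorem tangentMap_congr {E₁ : Type*} [NormedAddCommGroup E₁] [NormedSpace ℝ E₁]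
    {H₁ : Type*} [TopologicalSpace H₁] {I₁ : ModelWithCorners ℝ E₁ H₁}
    {Q : Type*} [TopologicalSpace Q] [ChartedSpace H₁ Q]
    {E₂ : Type*} [NormedAddCommGroup E₂] [NormedSpace ℝ E₂]
    {H₂ : Type*} [TopologicalSpace H₂] {I₂ : ModelWithCorners ℝ E₂ H₂}
    {N : Type*} [TopologicalSpace N] [ChartedSpace H₂ N] {f g : Q → N} {X : TangentBundle I₁ Q}
    (hfg : f =ᶠ[𝓝 X.proj] g) : tangentMap I₁ I₂ f X = tangentMap I₁ I₂ g X := by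
  have h1 : f X.proj = g X.proj := hfg.eq_of_nhds
  have h2 := hfg.mfderiv_eq (I := I₁) (I' := I₂)
  exact TotalSpace.ext h1 (heq_of_eq (congrArg (fun T : E₁ →L[ℝ] E₂ ↦ T X.2) h2))

section AdaptedBase

variable {EM : Type*} [NormedAddCommGroup EM] [NormedSpace ℝ EM]
  {M : Type*} [TopologicalSpace M] [ChartedSpace EM M] [IsManifold 𝓘(ℝ, EM) ∞ M]
  {N : Type*} [TopologicalSpace N] [ChartedSpace EM N] [IsManifold 𝓘(ℝ, EM) ∞ N]
  {F₀ : Type*} [NormedAddCommGroup F₀] [NormedSpace ℝ F₀]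
  {F : N → Type*} [TopologicalSpace (TotalSpace F₀ F)]
  [∀ y, AddCommGroup (F y)] [∀ y, Module ℝ (F y)] [∀ y, TopologicalSpace (F y)]
  [FiberBundle F₀ F] [VectorBundle ℝ F₀ F] [ContMDiffVectorBundle ∞ F₀ F 𝓘(ℝ, EM)]
  {h : M ≃ₘ^∞⟮𝓘(ℝ, EM), 𝓘(ℝ, EM)⟯ N} {η : N ≃ₘ^∞⟮𝓘(ℝ, EM), 𝓘(ℝ, EM)⟯ M}
  {P₀ : Type*} [NormedAddCommGroup P₀] [NormedSpace ℝ P₀]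
  {P : M → Type*} [TopologicalSpace (TotalSpace P₀ P)]
  [∀ x, AddCommGroup (P x)] [∀ x, Module ℝ (P x)] [∀ x, TopologicalSpace (P x)]
  [FiberBundle P₀ P] [VectorBundle ℝ P₀ P] [ContMDiffVectorBundle ∞ P₀ P 𝓘(ℝ, EM)]
  {A : GenLieAlgebroid F₀ F h η}

theorem mk_vertVec (u : TotalSpace P₀ P) (ε : P u.proj) :
    (⟨u, vertVec u ε⟩ : TangentBundle (𝓘(ℝ, EM).prod 𝓘(ℝ, P₀)) (TotalSpace P₀ P)) =
      tangentMap 𝓘(ℝ, ℝ) (𝓘(ℝ, EM).prod 𝓘(ℝ, P₀))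
        (fun t : ℝ ↦ (⟨u.proj, u.2 + t • ε⟩ : TotalSpace P₀ P)) ⟨0, 1⟩ :=
  mk_transport _ _ _

/-- The fibre coordinate `v ↦ (e v).2` in the preferred trivialization at `u`, differentiated
at `u`. -/
def fibreDeriv (u : TotalSpace P₀ P) :
    TangentSpace (𝓘(ℝ, EM).prod 𝓘(ℝ, P₀)) u →L[ℝ] P₀ :=
  mfderiv (𝓘(ℝ, EM).prod 𝓘(ℝ, P₀)) 𝓘(ℝ, P₀) (fun v ↦ (trivializationAt P₀ P u.proj v).2) u

theorem mdifferentiableAt_fibreCoord (u : TotalSpace P₀ P) :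
    MDifferentiableAt (𝓘(ℝ, EM).prod 𝓘(ℝ, P₀)) 𝓘(ℝ, P₀)
      (fun v ↦ (trivializationAt P₀ P u.proj v).2) u := by
  have h1 := (contMDiffAt_totalSpace.1
    (contMDiffAt_id (I := 𝓘(ℝ, EM).prod 𝓘(ℝ, P₀)) (n := ∞) (x := u))).2
  exact h1.mdifferentiableAt (by simp)

theorem fibreDeriv_vertVec (u : TotalSpace P₀ P) (ε : P u.proj) :
    fibreDeriv (EM := EM) u (vertVec u ε) =
      (trivializationAt P₀ P u.proj).linearMapAt ℝ u.proj ε := by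
  set e := trivializationAt P₀ P u.proj with he
  have hu : u.proj ∈ e.baseSet := mem_baseSet_trivializationAt P₀ P u.proj
  have h0 : (⟨u.proj, u.2 + (0 : ℝ) • ε⟩ : TotalSpace P₀ P) = u := by simp
  have h1 : tangentMap (𝓘(ℝ, EM).prod 𝓘(ℝ, P₀)) 𝓘(ℝ, P₀) (fun v ↦ (e v).2) ⟨u, vertVec u ε⟩ =
      tangentMap 𝓘(ℝ, ℝ) 𝓘(ℝ, P₀)
        ((fun v ↦ (e v).2) ∘ fun t : ℝ ↦ (⟨u.proj, u.2 + t • ε⟩ : TotalSpace P₀ P)) ⟨0, 1⟩ := by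
    have hg : MDifferentiableAt (𝓘(ℝ, EM).prod 𝓘(ℝ, P₀)) 𝓘(ℝ, P₀) (fun v ↦ (e v).2)
        (⟨u.proj, u.2 + (0 : ℝ) • ε⟩ : TotalSpace P₀ P) := by
      rw [h0]
      exact mdifferentiableAt_fibreCoord u
    rw [mk_vertVec]
    exact (tangentMap_comp_at _ hg (mdifferentiable_fibreLine u ε)).symm
  have h2 : ((fun v ↦ (e v).2) ∘ fun t : ℝ ↦ (⟨u.proj, u.2 + t • ε⟩ : TotalSpace P₀ P)) =
      fun t : ℝ ↦ e.linearMapAt ℝ u.proj u.2 + t • e.linearMapAt ℝ u.proj ε := by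
    funext t
    rw [← map_smul, ← map_add, Trivialization.linearMapAt_apply, if_pos hu]
    rfl
  rw [h2] at h1
  have h3 : HasDerivAt (fun t : ℝ ↦ e.linearMapAt ℝ u.proj u.2 + t • e.linearMapAt ℝ u.proj ε)
      (e.linearMapAt ℝ u.proj ε) 0 := by
    simpa using ((hasDerivAt_id (0 : ℝ)).smul_const (e.linearMapAt ℝ u.proj ε)).const_add
      (e.linearMapAt ℝ u.proj u.2)
  have h4 := congrArg (fun q : TangentBundle 𝓘(ℝ, P₀) P₀ ↦ (q.2 : P₀)) h1
  refine h4.trans ?_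
  change (mfderiv 𝓘(ℝ, ℝ) 𝓘(ℝ, P₀) _ (0 : ℝ)) (1 : ℝ) = _
  rw [mfderiv_eq_fderiv]
  exact (congrArg (fun T : ℝ →L[ℝ] P₀ ↦ T 1) h3.hasFDerivAt.fderiv).trans (by simp; rfl)

/-- The base point and the fibre coordinate together are a local diffeomorphism, so a tangent vector
killed by both derivatives vanishes. -/
theorem eq_zero_of_proj_eq_zero_of_fibreDeriv_eq_zero (u : TotalSpace P₀ P)
    (w : TangentSpace (𝓘(ℝ, EM).prod 𝓘(ℝ, P₀)) u)
    (hw : mfderiv (𝓘(ℝ, EM).prod 𝓘(ℝ, P₀)) 𝓘(ℝ, EM) (TotalSpace.proj : TotalSpace P₀ P → M) u w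
      = 0) (hw' : fibreDeriv u w = 0) : w = 0 := by
  set e := trivializationAt P₀ P u.proj with he
  have hu : u.proj ∈ e.baseSet := mem_baseSet_trivializationAt P₀ P u.proj
  have hus : u ∈ e.source := e.mem_source.2 hu
  have hπ : MDifferentiableAt (𝓘(ℝ, EM).prod 𝓘(ℝ, P₀)) 𝓘(ℝ, EM)
      (TotalSpace.proj : TotalSpace P₀ P → M) u :=
    ((Bundle.contMDiff_proj (n := ∞) P).contMDiffAt).mdifferentiableAt (by simp)
  let φ : TotalSpace P₀ P → M × P₀ := fun v ↦ (v.proj, (e v).2)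
  have hφ : MDifferentiableAt (𝓘(ℝ, EM).prod 𝓘(ℝ, P₀)) (𝓘(ℝ, EM).prod 𝓘(ℝ, P₀)) φ u :=
    hπ.prodMk (mdifferentiableAt_fibreCoord u)
  have hφw : mfderiv (𝓘(ℝ, EM).prod 𝓘(ℝ, P₀)) (𝓘(ℝ, EM).prod 𝓘(ℝ, P₀)) φ u w = 0 := by
    have := mfderiv_prodMk hπ (mdifferentiableAt_fibreCoord u)
    refine (congrArg (fun T : EM × P₀ →L[ℝ] EM × P₀ ↦ T w) this).trans ?_
    exact Prod.ext hw hw'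
  have hφu : φ u ∈ e.target := e.mem_target.2 hu
  have hs : MDifferentiableAt (𝓘(ℝ, EM).prod 𝓘(ℝ, P₀)) (𝓘(ℝ, EM).prod 𝓘(ℝ, P₀))
      e.toOpenPartialHomeomorph.symm (φ u) :=
    ((e.contMDiffOn_symm (IB := 𝓘(ℝ, EM)) (n := ∞)).contMDiffAt
      (e.open_target.mem_nhds hφu)).mdifferentiableAt (by simp)
  have hid : e.toOpenPartialHomeomorph.symm ∘ φ =ᶠ[𝓝 u] id := by
    filter_upwards [e.open_source.mem_nhds hus] with v hv
    exact e.symm_apply_mk_proj hv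
  have h1 := (mfderiv_comp u hs hφ).symm.trans
    (hid.mfderiv_eq (I := 𝓘(ℝ, EM).prod 𝓘(ℝ, P₀)) (I' := 𝓘(ℝ, EM).prod 𝓘(ℝ, P₀)))
  rw [mfderiv_id] at h1
  have h2 := congrArg (fun T : EM × P₀ →L[ℝ] EM × P₀ ↦ T w) h1
  have h3 : mfderiv (𝓘(ℝ, EM).prod 𝓘(ℝ, P₀)) (𝓘(ℝ, EM).prod 𝓘(ℝ, P₀))
      e.toOpenPartialHomeomorph.symm (φ u)
      (mfderiv (𝓘(ℝ, EM).prod 𝓘(ℝ, P₀)) (𝓘(ℝ, EM).prod 𝓘(ℝ, P₀)) φ u w) = 0 := by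
    rw [hφw]; exact map_zero _
  exact h2.symm.trans h3

theorem eq_vertVec_iff (u : TotalSpace P₀ P) (ε : P u.proj)
    (w : TangentSpace (𝓘(ℝ, EM).prod 𝓘(ℝ, P₀)) u) :
    w = vertVec u ε ↔
      mfderiv (𝓘(ℝ, EM).prod 𝓘(ℝ, P₀)) 𝓘(ℝ, EM) (TotalSpace.proj : TotalSpace P₀ P → M) u w = 0 ∧
      fibreDeriv u w = (trivializationAt P₀ P u.proj).linearMapAt ℝ u.proj ε := by
  constructor
  · rintro rfl
    exact ⟨proj_vertVec u ε, fibreDeriv_vertVec u ε⟩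
  · rintro ⟨h1, h2⟩
    rw [← sub_eq_zero]
    refine eq_zero_of_proj_eq_zero_of_fibreDeriv_eq_zero u _ ?_ ?_
    · exact (map_sub (mfderiv (𝓘(ℝ, EM).prod 𝓘(ℝ, P₀)) 𝓘(ℝ, EM)
        (TotalSpace.proj : TotalSpace P₀ P → M) u) _ _).trans
          (by rw [h1, proj_vertVec]; exact sub_zero _)
    · rw [map_sub, h2, fibreDeriv_vertVec, sub_self]

/-- The vertical lift as a linear map. -/
def vertLiftₗ (A : GenLieAlgebroid F₀ F h η) (u : TotalSpace P₀ P) : P u.proj →ₗ[ℝ] Fib A u where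
  toFun := vertLift A u
  map_add' ε ε' := by
    refine Subtype.ext (Prod.ext (add_zero (0 : F (h u.proj))).symm ?_)
    refine ((eq_vertVec_iff u (ε + ε') (vertVec u ε + vertVec u ε')).2 ⟨?_, ?_⟩).symm
    · refine (map_add (mfderiv (𝓘(ℝ, EM).prod 𝓘(ℝ, P₀)) 𝓘(ℝ, EM)
        (TotalSpace.proj : TotalSpace P₀ P → M) u) _ _).trans ?_
      rw [proj_vertVec, proj_vertVec]
      exact add_zero _
    · rw [map_add, map_add, fibreDeriv_vertVec, fibreDeriv_vertVec]
  map_smul' c ε := by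
    refine Subtype.ext (Prod.ext (smul_zero (A := F (h u.proj)) c).symm ?_)
    refine ((eq_vertVec_iff u (c • ε) (c • vertVec u ε)).2 ⟨?_, ?_⟩).symm
    · refine (map_smul (mfderiv (𝓘(ℝ, EM).prod 𝓘(ℝ, P₀)) 𝓘(ℝ, EM)
        (TotalSpace.proj : TotalSpace P₀ P → M) u) _ _).trans ?_
      rw [proj_vertVec]
      exact smul_zero _
    · rw [map_smul, map_smul, fibreDeriv_vertVec]

theorem vertLiftₗ_injective (u : TotalSpace P₀ P) : Function.Injective (vertLiftₗ A u) := by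
  rw [injective_iff_map_eq_zero]
  intro ε hε
  have h1 : vertVec (EM := EM) u ε = 0 := congrArg (fun ξ : Fib A u ↦ ξ.1.2) hε
  have h2 := fibreDeriv_vertVec (EM := EM) u ε
  rw [h1, map_zero] at h2
  have hu := mem_baseSet_trivializationAt P₀ P u.proj
  rw [Trivialization.linearMapAt_def_of_mem _ hu] at h2
  exact ((trivializationAt P₀ P u.proj).linearEquivAt ℝ u.proj hu).map_eq_zero_iff.1 h2.symm

theorem mem_vert_iff (u : TotalSpace P₀ P) (ξ : Fib A u) : ξ ∈ Vert A u ↔ ξ.1.1 = 0 :=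
  Iff.rfl

theorem vertLift_mem_vert (u : TotalSpace P₀ P) (ε : P u.proj) : vertLift A u ε ∈ Vert A u :=
  rfl

theorem exists_vertLift_eq {u : TotalSpace P₀ P} {ξ : Fib A u} (hξ : ξ ∈ Vert A u) :
    ∃ ε, vertLift A u ε = ξ := by
  have hu := mem_baseSet_trivializationAt P₀ P u.proj
  let L := (trivializationAt P₀ P u.proj).linearEquivAt ℝ u.proj hu
  refine ⟨L.symm (fibreDeriv u ξ.1.2), Subtype.ext (Prod.ext hξ.symm ?_)⟩
  refine ((eq_vertVec_iff u _ _).2 ⟨?_, ?_⟩).symm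
  · have h1 : mfderiv (𝓘(ℝ, EM).prod 𝓘(ℝ, P₀)) 𝓘(ℝ, EM)
        (TotalSpace.proj : TotalSpace P₀ P → M) u ξ.1.2 = A.anchorAt u.proj ξ.1.1 := ξ.2
    rw [h1, (mem_vert_iff u ξ).1 hξ, map_zero]
  · rw [Trivialization.linearMapAt_def_of_mem _ hu]
    exact (L.apply_symm_apply _).symm

variable (C : Connection P₀ P A)

theorem horLift_mem_horiz (u : TotalSpace P₀ P) (z : F (h u.proj)) : horLift C u z ∈ Horiz C u :=
  (exists_horizontal C u z).choose_spec.1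

@[simp]
theorem horLift_fst (u : TotalSpace P₀ P) (z : F (h u.proj)) : (horLift C u z).1.1 = z :=
  (exists_horizontal C u z).choose_spec.2

theorem eq_zero_of_mem_horiz_of_mem_vert {u : TotalSpace P₀ P} {ξ : Fib A u}
    (hξ : ξ ∈ Horiz C u) (hξ' : ξ ∈ Vert A u) : ξ = 0 := by
  have h1 := C.split u ⟨ξ, hξ'⟩
  have h2 : C.Γ u ξ = 0 := hξ
  exact (congrArg Subtype.val (h1.symm.trans h2))

theorem horLift_eq_of_mem_horiz {u : TotalSpace P₀ P} {ξ : Fib A u} (hξ : ξ ∈ Horiz C u) :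
    horLift C u ξ.1.1 = ξ := by
  rw [← sub_eq_zero]
  refine eq_zero_of_mem_horiz_of_mem_vert C
    (Submodule.sub_mem _ (horLift_mem_horiz C u _) hξ) ((mem_vert_iff u _).2 ?_)
  simp

theorem sub_Γ_mem_horiz {u : TotalSpace P₀ P} (ξ : Fib A u) :
    ξ - (C.Γ u ξ : Fib A u) ∈ Horiz C u := by
  simp [Horiz, C.split]

theorem horLift_fst_eq {u : TotalSpace P₀ P} (ξ : Fib A u) :
    horLift C u ξ.1.1 = ξ - (C.Γ u ξ : Fib A u) := by
  have h1 : ((C.Γ u ξ : Vert A u) : Fib A u).1.1 = 0 := (C.Γ u ξ).2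
  rw [← horLift_eq_of_mem_horiz C (sub_Γ_mem_horiz C ξ)]
  simp [h1]

/-- The horizontal lift as a linear map. -/
def horLiftₗ (u : TotalSpace P₀ P) : F (h u.proj) →ₗ[ℝ] Fib A u where
  toFun := horLift C u
  map_add' z z' := by
    have := horLift_eq_of_mem_horiz C
      (Submodule.add_mem _ (horLift_mem_horiz C u z) (horLift_mem_horiz C u z'))
    simpa using this
  map_smul' c z := by
    have := horLift_eq_of_mem_horiz C (Submodule.smul_mem _ c (horLift_mem_horiz C u z))
    simpa using this

/-- The splitting of the generalized tangent bundle into its horizontal part, a copy of the pulled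
back `F`, and its vertical part, a copy of the pulled back `P`. -/
def fibEquiv (u : TotalSpace P₀ P) : (F (h u.proj) × P u.proj) ≃ₗ[ℝ] Fib A u :=
  LinearEquiv.ofBijective ((horLiftₗ C u).coprod (vertLiftₗ A u)) <| by
    constructor
    · rw [injective_iff_map_eq_zero]
      rintro ⟨z, ε⟩ hzε
      have h1 : horLift C u z + vertLift A u ε = 0 := hzε
      have h2 : z = 0 := by
        have := congrArg (fun ξ : Fib A u ↦ ξ.1.1) h1
        simpa [vertLift] using this
      subst h2
      have h3 : horLiftₗ C u 0 + vertLiftₗ A u ε = 0 := h1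
      rw [map_zero, zero_add] at h3
      rw [vertLiftₗ_injective (A := A) u (h3.trans (map_zero _).symm)]
      rfl
    · intro ξ
      obtain ⟨ε, hε⟩ := exists_vertLift_eq (C.Γ u ξ).2
      refine ⟨(ξ.1.1, ε), ?_⟩
      change horLift C u ξ.1.1 + vertLift A u ε = ξ
      rw [hε, horLift_fst_eq, sub_add_cancel]

theorem fibEquiv_apply (u : TotalSpace P₀ P) (q : F (h u.proj) × P u.proj) :
    fibEquiv C u q = horLift C u q.1 + vertLift A u q.2 :=
  rfl

variable {p r : ℕ} {U : Set M} {e : Fin r → ∀ x, P x} {W : Set N} {t : Fin p → ∀ y, F y}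

/-- The adapted base at a point. -/
def adaptedBasis (he : IsLocalFrameOn 𝓘(ℝ, EM) P₀ ∞ e U) (ht : IsLocalFrameOn 𝓘(ℝ, EM) F₀ ∞ t W)
    {u : TotalSpace P₀ P} (hu : u.proj ∈ U) (hu' : h u.proj ∈ W) :
    Module.Basis (Fin p ⊕ Fin r) ℝ (Fib A u) :=
  ((ht.toBasisAt hu').prod (he.toBasisAt hu)).map (fibEquiv C u)

theorem adaptedBasis_inl (he : IsLocalFrameOn 𝓘(ℝ, EM) P₀ ∞ e U)
    (ht : IsLocalFrameOn 𝓘(ℝ, EM) F₀ ∞ t W)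
    {u : TotalSpace P₀ P} (hu : u.proj ∈ U) (hu' : h u.proj ∈ W) (α : Fin p) :
    adaptedBasis C he ht hu hu' (Sum.inl α) = adaptedH C t α u := by
  rw [adaptedBasis, Module.Basis.map_apply, fibEquiv_apply, Module.Basis.prod_apply_inl_fst,
    Module.Basis.prod_apply_inl_snd, IsLocalFrameOn.toBasisAt_coe]
  exact (congrArg (horLift C u _ + ·) (map_zero (vertLiftₗ A u))).trans (add_zero _)

theorem adaptedBasis_inr (he : IsLocalFrameOn 𝓘(ℝ, EM) P₀ ∞ e U)
    (ht : IsLocalFrameOn 𝓘(ℝ, EM) F₀ ∞ t W)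
    {u : TotalSpace P₀ P} (hu : u.proj ∈ U) (hu' : h u.proj ∈ W) (a : Fin r) :
    adaptedBasis C he ht hu hu' (Sum.inr a) = adaptedV A e a u := by
  rw [adaptedBasis, Module.Basis.map_apply, fibEquiv_apply, Module.Basis.prod_apply_inr_fst,
    Module.Basis.prod_apply_inr_snd, IsLocalFrameOn.toBasisAt_coe]
  exact (congrArg (· + vertLift A u _) (map_zero (horLiftₗ C u))).trans (zero_add _)

/-- The vertical lift of `ε` is the image of the constant field `(0, 1)` under the tangent map of
`(u, s) ↦ u + s ε (π u)`, hence smooth. -/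
theorem smoothSec_vertLift {ε : ∀ x, P x}
    (hε : ContMDiffOn 𝓘(ℝ, EM) (𝓘(ℝ, EM).prod 𝓘(ℝ, P₀)) ∞
      (fun x ↦ (⟨x, ε x⟩ : TotalSpace P₀ P)) U) (hU : IsOpen U) :
    SmoothSec A (TotalSpace.proj ⁻¹' U) (fun u : TotalSpace P₀ P ↦ vertLift A u (ε u.proj)) := by
  have h0 : SmoothSec A (TotalSpace.proj ⁻¹' U : Set (TotalSpace P₀ P)) (fun _ ↦ 0) := .zero
  refine ⟨h0.1, ?_⟩
  let Φ : TotalSpace P₀ P × ℝ → TotalSpace P₀ P :=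
    fun q ↦ ⟨q.1.proj, q.1.2 + q.2 • ε q.1.proj⟩
  have hU' : IsOpen ((TotalSpace.proj : TotalSpace P₀ P → M) ⁻¹' U) :=
    hU.preimage (FiberBundle.continuous_proj P₀ P)
  have hΦ : ContMDiffOn ((𝓘(ℝ, EM).prod 𝓘(ℝ, P₀)).prod 𝓘(ℝ, ℝ)) (𝓘(ℝ, EM).prod 𝓘(ℝ, P₀)) ∞ Φ
      ((TotalSpace.proj ⁻¹' U) ×ˢ univ) := by
    have h1 : ContMDiffOn ((𝓘(ℝ, EM).prod 𝓘(ℝ, P₀)).prod 𝓘(ℝ, ℝ)) (𝓘(ℝ, EM).prod 𝓘(ℝ, P₀)) ∞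
        (fun q : TotalSpace P₀ P × ℝ ↦ (⟨q.1.proj, ε q.1.proj⟩ : TotalSpace P₀ P))
        ((TotalSpace.proj ⁻¹' U) ×ˢ univ) :=
      hε.comp ((contMDiff_proj P).comp contMDiff_fst).contMDiffOn fun q hq ↦ hq.1
    have h2 : ContMDiffOn ((𝓘(ℝ, EM).prod 𝓘(ℝ, P₀)).prod 𝓘(ℝ, ℝ)) (𝓘(ℝ, EM).prod 𝓘(ℝ, P₀)) ∞
        (fun q : TotalSpace P₀ P × ℝ ↦ (⟨q.1.proj, q.1.2⟩ : TotalSpace P₀ P))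
        ((TotalSpace.proj ⁻¹' U) ×ˢ univ) := contMDiff_fst.contMDiffOn
    have h3 := contMDiffOn_smul_add_smul_along (c₁ := fun _ ↦ (1 : ℝ)) (c₂ := fun q ↦ q.2)
      contMDiffOn_const contMDiff_snd.contMDiffOn h2 h1
    simpa only [one_smul] using h3
  let X : TotalSpace P₀ P →
      TangentBundle ((𝓘(ℝ, EM).prod 𝓘(ℝ, P₀)).prod 𝓘(ℝ, ℝ)) (TotalSpace P₀ P × ℝ) :=
    fun u ↦ (equivTangentBundleProd (𝓘(ℝ, EM).prod 𝓘(ℝ, P₀)) (TotalSpace P₀ P) 𝓘(ℝ, ℝ) ℝ).symm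
      (⟨u, 0⟩, ⟨0, 1⟩)
  have hX : ContMDiff (𝓘(ℝ, EM).prod 𝓘(ℝ, P₀))
      ((𝓘(ℝ, EM).prod 𝓘(ℝ, P₀)).prod 𝓘(ℝ, ℝ)).tangent ∞ X :=
    contMDiff_equivTangentBundleProd_symm.comp
      ((contMDiff_zeroSection ℝ (F := EM × P₀)
        (TangentSpace (𝓘(ℝ, EM).prod 𝓘(ℝ, P₀)) : TotalSpace P₀ P → Type _)).prodMk
        contMDiff_const)
  have hΦX := contMDiffOn_mfderiv_along (hU'.prod isOpen_univ) hΦ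
    (hX.contMDiffOn (s := TotalSpace.proj ⁻¹' U)) (fun u hu ↦ ⟨hu, mem_univ _⟩)
  refine hΦX.congr fun u hu ↦ ?_
  refine (mk_vertVec u (ε u.proj)).trans ?_
  have h1 : (fun s : ℝ ↦ (⟨u.proj, u.2 + s • ε u.proj⟩ : TotalSpace P₀ P)) =
      Φ ∘ fun s : ℝ ↦ (u, s) := rfl
  have h2 : MDifferentiableAt 𝓘(ℝ, ℝ) ((𝓘(ℝ, EM).prod 𝓘(ℝ, P₀)).prod 𝓘(ℝ, ℝ))
      (fun s : ℝ ↦ (u, s)) 0 := mdifferentiableAt_const.prodMk mdifferentiableAt_id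
  have h3 : MDifferentiableAt ((𝓘(ℝ, EM).prod 𝓘(ℝ, P₀)).prod 𝓘(ℝ, ℝ)) (𝓘(ℝ, EM).prod 𝓘(ℝ, P₀))
      Φ (u, (0 : ℝ)) :=
    (hΦ.contMDiffAt ((hU'.prod isOpen_univ).mem_nhds ⟨hu, mem_univ _⟩)).mdifferentiableAt (by simp)
  rw [h1, tangentMap_comp_at _ h3 h2]
  congr 1
  refine TotalSpace.ext rfl (heq_of_eq ?_)
  change mfderiv 𝓘(ℝ, ℝ) ((𝓘(ℝ, EM).prod 𝓘(ℝ, P₀)).prod 𝓘(ℝ, ℝ)) (fun s : ℝ ↦ (u, s)) 0 (1 : ℝ) = _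
  rw [mfderiv_prod_right]
  rfl

/-- The local lift that is built here in a trivialization of `P` is not horizontal; subtracting its
vertical part makes it so, and keeps it smooth because the connection is smooth. -/
theorem smoothSec_horLift [FiniteDimensional ℝ EM] [T2Space M] [T2Space N] {z : ∀ y, F y}
    (hz : ContMDiffOn 𝓘(ℝ, EM) (𝓘(ℝ, EM).prod 𝓘(ℝ, F₀)) ∞
      (fun y ↦ (⟨y, z y⟩ : TotalSpace F₀ F)) W) (hW : IsOpen W) :
    SmoothSec A ((fun u : TotalSpace P₀ P ↦ h u.proj) ⁻¹' W)
      (fun u ↦ horLift C u (z (h u.proj))) := by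
  have hhπ : Continuous fun u : TotalSpace P₀ P ↦ h u.proj :=
    h.continuous.comp (FiberBundle.continuous_proj P₀ P)
  set O := (fun u : TotalSpace P₀ P ↦ h u.proj) ⁻¹' W with hOdef
  have hO : IsOpen O := hW.preimage hhπ
  refine SmoothSec.of_locally fun u₀ hu₀ ↦ ?_
  set e := trivializationAt P₀ P u₀.proj with he
  refine ⟨e.source, e.open_source,
    e.mem_source.2 (mem_baseSet_trivializationAt P₀ P u₀.proj), ?_⟩
  set O' := O ∩ e.source with hO'def
  have hO' : IsOpen O' := hO.inter e.open_source
  have ha : ContMDiffOn 𝓘(ℝ, EM) 𝓘(ℝ, EM).tangent ∞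
      (fun x ↦ (⟨x, A.anchorAt x (z (h x))⟩ : TangentBundle 𝓘(ℝ, EM) M)) (h ⁻¹' W) := by
    intro x hx
    refine (A.contMDiffAt_anchorAt (fun x ↦ z (h x)) x ?_).contMDiffWithinAt
    exact ((hz.contMDiffAt (hW.mem_nhds hx)).comp x h.contMDiff.contMDiffAt)
  let X : TotalSpace P₀ P → TangentBundle (𝓘(ℝ, EM).prod 𝓘(ℝ, P₀)) (M × P₀) :=
    fun u ↦ (equivTangentBundleProd 𝓘(ℝ, EM) M 𝓘(ℝ, P₀) P₀).symm
      (⟨u.proj, A.anchorAt u.proj (z (h u.proj))⟩, ⟨(e u).2, 0⟩)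
  have hX : ContMDiffOn (𝓘(ℝ, EM).prod 𝓘(ℝ, P₀)) (𝓘(ℝ, EM).prod 𝓘(ℝ, P₀)).tangent ∞ X O' := by
    refine contMDiff_equivTangentBundleProd_symm.comp_contMDiffOn (ContMDiffOn.prodMk ?_ ?_)
    · exact ha.comp (contMDiff_proj P).contMDiffOn fun u hu ↦ hu.1
    · have h1 : ContMDiffOn (𝓘(ℝ, EM).prod 𝓘(ℝ, P₀)) 𝓘(ℝ, P₀) ∞
          (fun u : TotalSpace P₀ P ↦ (e u).2) O' :=
        contMDiff_snd.comp_contMDiffOn (e.contMDiffOn.mono inter_subset_right)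
      exact (contMDiff_zeroSection ℝ (F := P₀)
        (TangentSpace 𝓘(ℝ, P₀) : P₀ → Type _)).comp_contMDiffOn h1
  have hXe : ∀ u ∈ O', (X u).proj ∈ e.target := fun u hu ↦
    e.mem_target.2 (e.mem_source.1 hu.2)
  have hΨ : ContMDiffOn (𝓘(ℝ, EM).prod 𝓘(ℝ, P₀)) (𝓘(ℝ, EM).prod 𝓘(ℝ, P₀)) ∞
      e.toOpenPartialHomeomorph.symm e.target := e.contMDiffOn_symm
  have hΨX := contMDiffOn_mfderiv_along e.open_target hΨ hX hXe
  -- in the trivialization, lift the anchor vector field with fibre component zero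
  have hex : ∀ u : TotalSpace P₀ P, ∃ ξ : Fib A u, ξ.1.1 = z (h u.proj) ∧ (u ∈ O' →
      (⟨u, ξ.1.2⟩ : TangentBundle (𝓘(ℝ, EM).prod 𝓘(ℝ, P₀)) (TotalSpace P₀ P)) =
        tangentMap (𝓘(ℝ, EM).prod 𝓘(ℝ, P₀)) (𝓘(ℝ, EM).prod 𝓘(ℝ, P₀))
          e.toOpenPartialHomeomorph.symm (X u)) := by
    intro u
    by_cases hu : u ∈ O'
    · set Y := tangentMap (𝓘(ℝ, EM).prod 𝓘(ℝ, P₀)) (𝓘(ℝ, EM).prod 𝓘(ℝ, P₀))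
          e.toOpenPartialHomeomorph.symm (X u) with hYdef
      have hY : Y.proj = u := e.symm_apply_mk_proj hu.2
      obtain ⟨w, hw⟩ : ∃ w, (⟨u, w⟩ : TangentBundle (𝓘(ℝ, EM).prod 𝓘(ℝ, P₀))
          (TotalSpace P₀ P)) = Y := ⟨_, mk_transport _ hY Y.2⟩
      have hπ : MDifferentiableAt (𝓘(ℝ, EM).prod 𝓘(ℝ, P₀)) 𝓘(ℝ, EM)
          (TotalSpace.proj : TotalSpace P₀ P → M) (e.toOpenPartialHomeomorph.symm (X u).1) :=
        ((Bundle.contMDiff_proj (n := ∞) P).contMDiffAt).mdifferentiableAt (by simp)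
      have hs : MDifferentiableAt (𝓘(ℝ, EM).prod 𝓘(ℝ, P₀)) (𝓘(ℝ, EM).prod 𝓘(ℝ, P₀))
          e.toOpenPartialHomeomorph.symm (X u).1 :=
        (hΨ.contMDiffAt (e.open_target.mem_nhds (hXe u hu))).mdifferentiableAt (by simp)
      have hfst : (TotalSpace.proj : TotalSpace P₀ P → M) ∘ e.toOpenPartialHomeomorph.symm
          =ᶠ[𝓝 (X u).proj] Prod.fst := by
        filter_upwards [e.open_target.mem_nhds (hXe u hu)] with q hq
        exact e.proj_symm_apply hq
      have h1 : tangentMap (𝓘(ℝ, EM).prod 𝓘(ℝ, P₀)) 𝓘(ℝ, EM)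
          (TotalSpace.proj : TotalSpace P₀ P → M) ⟨u, w⟩ =
          ⟨u.proj, A.anchorAt u.proj (z (h u.proj))⟩ := by
        rw [hw, hYdef, ← tangentMap_comp_at _ hπ hs, tangentMap_congr hfst, tangentMap_prodFst]
        rfl
      have h2 : mfderiv (𝓘(ℝ, EM).prod 𝓘(ℝ, P₀)) 𝓘(ℝ, EM)
          (TotalSpace.proj : TotalSpace P₀ P → M) u w = A.anchorAt u.proj (z (h u.proj)) :=
        TotalSpace.mk_injective _ h1
      exact ⟨⟨(z (h u.proj), w), h2⟩, rfl, fun _ ↦ hw⟩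
    · exact ⟨horLift C u (z (h u.proj)), horLift_fst C u _, fun h ↦ absurd h hu⟩
  choose ξ hξ hξ' using hex
  have hξs : SmoothSec A O' ξ := by
    refine ⟨?_, hΨX.congr fun u hu ↦ hξ' u hu⟩
    simp only [hξ]
    exact hz.comp (h.contMDiff.comp (contMDiff_proj P)).contMDiffOn fun u hu ↦ hu.1
  refine (hξs.sub (C.smooth O' hO' ξ hξs)).congr fun u hu ↦ ?_
  rw [← horLift_fst_eq C (ξ u), hξ]

end AdaptedBase

/-! ### Gram matrices -/

section Gram

variable {V : Type*} [AddCommGroup V] [Module ℝ V] (G : V →ₗ[ℝ] V →ₗ[ℝ] ℝ)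
  {ι : Type*} [Fintype ι] [DecidableEq ι] {b : ι → V}

/-- The Gram matrix of a family of vectors. -/
def gram (b : ι → V) : Matrix ι ι ℝ := Matrix.of fun i j ↦ G (b i) (b j)

theorem gram_det_ne_zero (hb : LinearIndependent ℝ b)
    (hG : ∀ c : ι → ℝ, (∀ j, G (∑ i, c i • b i) (b j) = 0) → ∑ i, c i • b i = 0) :
    (gram G b).det ≠ 0 := by
  intro hdet
  obtain ⟨c, hc, hc'⟩ := Matrix.exists_vecMul_eq_zero_iff.2 hdet
  refine hc (funext (Fintype.linearIndependent_iff.1 hb c (hG c fun j ↦ ?_)))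
  have := congrFun hc' j
  simpa [Matrix.vecMul, dotProduct, gram] using this

/-- The combination of the vectors `b` whose pairings with the `b j` are the prescribed `c j`. -/
def gramDual (b : ι → V) (c : ι → ℝ) : V := ∑ i, (∑ j, c j * (gram G b)⁻¹ j i) • b i

theorem gramDual_add (c c' : ι → ℝ) :
    gramDual G b (c + c') = gramDual G b c + gramDual G b c' := by
  simp only [gramDual, Pi.add_apply, add_mul, Finset.sum_add_distrib, add_smul]

theorem gramDual_smul (a : ℝ) (c : ι → ℝ) : gramDual G b (a • c) = a • gramDual G b c := by
  simp only [gramDual, Pi.smul_apply, smul_eq_mul, mul_assoc, ← Finset.mul_sum, mul_smul,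
    Finset.smul_sum]

theorem apply_gramDual (hdet : (gram G b).det ≠ 0) (c : ι → ℝ) (k : ι) :
    G (gramDual G b c) (b k) = c k := by
  have h1 : (gram G b)⁻¹ * gram G b = 1 := Matrix.nonsing_inv_mul _ hdet.isUnit
  have h2 : G (gramDual G b c) (b k) = Matrix.vecMul (Matrix.vecMul c (gram G b)⁻¹) (gram G b) k := by
    simp [gramDual, Matrix.vecMul, dotProduct, gram]
  rw [h2, Matrix.vecMul_vecMul, h1, Matrix.vecMul_one]

theorem pairing_sum (f a d : ι → ℝ) (w : ι → V) {x y : V}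
    (hy : ∀ i, G y (b i) = a i - G x (w i)) :
    G y (∑ i, f i • b i) = ∑ i, (f i * a i + G x (b i) * d i)
      - G x (∑ i, (f i • w i + d i • b i)) := by
  rw [map_sum, map_sum, ← Finset.sum_sub_distrib]
  refine Finset.sum_congr rfl fun i _ ↦ ?_
  simp only [map_smul, hy, map_add, smul_eq_mul]
  ring

/-- The linear algebra behind the component formulas: if `y ∈ S` pairs with the basis `b` of `S` like
`x`, up to the corrections `c`, then the midpoint of `x` and `y` has the coefficients of `x`,
corrected by half of the inverse Gram matrix applied to `c`. -/
theorem half_smul_add_eq_sum {S : Submodule ℝ V} (hsymm : ∀ x y, G x y = G y x)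
    (hbS : ∀ i, b i ∈ S) (hdet : (gram G b).det ≠ 0)
    (hsep : ∀ x ∈ S, (∀ i, G x (b i) = 0) → x = 0)
    {x y : V} (hy : y ∈ S) {k c : ι → ℝ} (hx : x = ∑ i, k i • b i)
    (hc : ∀ i, G y (b i) = G x (b i) + c i) :
    (1 / 2 : ℝ) • x + (1 / 2 : ℝ) • y
      = ∑ i, (k i + 1 / 2 * ∑ j, (gram G b)⁻¹ i j * c j) • b i := by
  have hxS : x ∈ S := hx ▸ Submodule.sum_mem _ fun i _ ↦ Submodule.smul_mem _ _ (hbS i)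
  have hdS : gramDual G b c ∈ S :=
    Submodule.sum_mem _ fun i _ ↦ Submodule.smul_mem _ _ (hbS i)
  have hyx : y = x + gramDual G b c := by
    rw [← sub_eq_zero]
    refine hsep _ (Submodule.sub_mem _ hy (Submodule.add_mem _ hxS hdS)) fun i ↦ ?_
    rw [map_sub, map_add, LinearMap.sub_apply, LinearMap.add_apply, apply_gramDual G hdet, hc]
    ring
  have htr : ∀ i j, (gram G b)⁻¹ i j = (gram G b)⁻¹ j i := by
    intro i j
    have h1 : (gram G b).transpose = gram G b := by
      ext i j
      exact hsymm _ _
    have h2 := Matrix.transpose_nonsing_inv (gram G b)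
    rw [h1] at h2
    exact congrFun (congrFun h2 j) i
  have hd : gramDual G b c = ∑ i, (∑ j, (gram G b)⁻¹ i j * c j) • b i := by
    refine Finset.sum_congr rfl fun i _ ↦ ?_
    congr 1
    exact Finset.sum_congr rfl fun j _ ↦ by rw [htr i j, mul_comm]
  rw [hyx, hd, hx]
  simp only [add_smul, mul_smul, Finset.sum_add_distrib, smul_add, ← Finset.smul_sum]
  module

end Gram

/-! ### Locality of distinguished connections, and smooth frames -/

section Frames

variable {EM : Type*} [NormedAddCommGroup EM] [NormedSpace ℝ EM]
  {M : Type*} [TopologicalSpace M] [ChartedSpace EM M] [IsManifold 𝓘(ℝ, EM) ∞ M]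
  {N : Type*} [TopologicalSpace N] [ChartedSpace EM N] [IsManifold 𝓘(ℝ, EM) ∞ N]
  {F₀ : Type*} [NormedAddCommGroup F₀] [NormedSpace ℝ F₀]
  {F : N → Type*} [TopologicalSpace (TotalSpace F₀ F)]
  [∀ y, AddCommGroup (F y)] [∀ y, Module ℝ (F y)] [∀ y, TopologicalSpace (F y)]
  [FiberBundle F₀ F] [VectorBundle ℝ F₀ F] [ContMDiffVectorBundle ∞ F₀ F 𝓘(ℝ, EM)]
  {h : M ≃ₘ^∞⟮𝓘(ℝ, EM), 𝓘(ℝ, EM)⟯ N} {η : N ≃ₘ^∞⟮𝓘(ℝ, EM), 𝓘(ℝ, EM)⟯ M}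
  {P₀ : Type*} [NormedAddCommGroup P₀] [NormedSpace ℝ P₀]
  {P : M → Type*} [TopologicalSpace (TotalSpace P₀ P)]
  [∀ x, AddCommGroup (P x)] [∀ x, Module ℝ (P x)] [∀ x, TopologicalSpace (P x)]
  [FiberBundle P₀ P] [VectorBundle ℝ P₀ P] [ContMDiffVectorBundle ∞ P₀ P 𝓘(ℝ, EM)]
  {A : GenLieAlgebroid F₀ F h η} {C : Connection P₀ P A}

section Locality

variable {O : Set (TotalSpace P₀ P)} {σ τ : ∀ u : TotalSpace P₀ P, Fib A u}
  {u : TotalSpace P₀ P}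

/-- Locality: the indicator function of an open set is smooth on that set, so the Leibniz rule
applies to it, and multiplying by it erases the values of a section elsewhere. -/
theorem DConnection.congr (Δ : DConnection C) (hO : IsOpen O) (hσ : SmoothSec A O σ)
    (hστ : ∀ v ∈ O, σ v = τ v) (hu : u ∈ O) (ξ : Fib A u) : Δ.D σ u ξ = Δ.D τ u ξ := by
  classical
  have hτ : SmoothSec A O τ := hσ.congr fun v hv ↦ (hστ v hv).symm
  let f : TotalSpace P₀ P → ℝ := O.indicator fun _ ↦ 1
  have hf1 : ∀ v ∈ O, f v = 1 := fun v hv ↦ indicator_of_mem hv _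
  have hf : ContMDiffOn (𝓘(ℝ, EM).prod 𝓘(ℝ, P₀)) 𝓘(ℝ, ℝ) ∞ f O :=
    contMDiffOn_const.congr hf1
  have hd : deriv A f ξ = 0 := by
    have hev : f =ᶠ[𝓝 u] fun _ ↦ 1 := by
      filter_upwards [hO.mem_nhds hu] with v hv using hf1 v hv
    rw [deriv_congr hev, deriv_const]
  have h1 := Δ.leibniz O hO f σ hf hσ u hu ξ
  have h2 := Δ.leibniz O hO f τ hf hτ u hu ξ
  have h3 : (fun v ↦ f v • σ v) = fun v ↦ f v • τ v := by
    funext v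
    by_cases hv : v ∈ O
    · rw [hστ v hv]
    · simp [f, hv]
  rw [hd, hf1 u hu, zero_smul, add_zero, one_smul] at h1 h2
  rw [← h1, ← h2, h3]

theorem DConnection.D_zero (Δ : DConnection C) (u : TotalSpace P₀ P) (ξ : Fib A u) :
    Δ.D (fun _ ↦ 0) u ξ = 0 := by
  have h1 := Δ.add univ isOpen_univ _ _ SmoothSec.zero SmoothSec.zero u (mem_univ u) ξ
  simp only [add_zero] at h1
  simpa using h1

theorem DConnection.D_sum_smul (Δ : DConnection C) (hO : IsOpen O) {ι : Type*} (s : Finset ι)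
    {f : ι → TotalSpace P₀ P → ℝ} {B : ι → ∀ u : TotalSpace P₀ P, Fib A u}
    (hf : ∀ i, ContMDiffOn (𝓘(ℝ, EM).prod 𝓘(ℝ, P₀)) 𝓘(ℝ, ℝ) ∞ (f i) O)
    (hB : ∀ i, SmoothSec A O (B i)) (hu : u ∈ O) (ξ : Fib A u) :
    Δ.D (fun v ↦ ∑ i ∈ s, f i v • B i v) u ξ
      = ∑ i ∈ s, (f i u • Δ.D (B i) u ξ + deriv A (f i) ξ • B i u) := by
  classical
  induction s using Finset.induction_on with
  | empty => simpa using Δ.D_zero u ξ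
  | insert i s hi ih =>
    simp only [Finset.sum_insert hi]
    rw [← ih, ← Δ.leibniz O hO (f i) (B i) (hf i) (hB i) u hu ξ]
    exact Δ.add O hO _ _ ((hB i).smul (hf i)) (.sum s fun j _ ↦ (hB j).smul (hf j)) u hu ξ

theorem deriv_sum_mul {ι : Type*} (s : Finset ι) {f f' : ι → TotalSpace P₀ P → ℝ}
    (hf : ∀ i, MDifferentiableAt (𝓘(ℝ, EM).prod 𝓘(ℝ, P₀)) 𝓘(ℝ, ℝ) (f i) u)
    (hf' : ∀ i, MDifferentiableAt (𝓘(ℝ, EM).prod 𝓘(ℝ, P₀)) 𝓘(ℝ, ℝ) (f' i) u) (ξ : Fib A u) :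
    deriv A (fun v ↦ ∑ i ∈ s, f i v * f' i v) ξ
      = ∑ i ∈ s, (f i u * deriv A (f' i) ξ + f' i u * deriv A (f i) ξ) := by
  classical
  suffices hs : MDifferentiableAt (𝓘(ℝ, EM).prod 𝓘(ℝ, P₀)) 𝓘(ℝ, ℝ)
      (fun v ↦ ∑ i ∈ s, f i v * f' i v) u ∧ deriv A (fun v ↦ ∑ i ∈ s, f i v * f' i v) ξ
      = ∑ i ∈ s, (f i u * deriv A (f' i) ξ + f' i u * deriv A (f i) ξ) from hs.2
  induction s using Finset.induction_on with
  | empty =>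
    simp only [Finset.sum_empty]
    exact ⟨mdifferentiableAt_const, deriv_const 0 ξ⟩
  | insert i s hi ih =>
    have hi' : MDifferentiableAt (𝓘(ℝ, EM).prod 𝓘(ℝ, P₀)) 𝓘(ℝ, ℝ)
      (fun v ↦ f i v * f' i v) u := (hf i).mul (hf' i)
    simp only [Finset.sum_insert hi]
    rw [← ih.2, ← deriv_mul (hf i) (hf' i)]
    exact ⟨hi'.add ih.1, deriv_add hi' ih.1 ξ⟩

end Locality

/-- `G` is nondegenerate on the whole fibre, because its two blocks are orthogonal to each other. -/
theorem PseudoMetric.eq_zero_of_forall (g : PseudoMetric C) {u : TotalSpace P₀ P} {ξ : Fib A u}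
    (hξ : ∀ ζ, g.G u ξ ζ = 0) : ξ = 0 := by
  set v : Fib A u := (C.Γ u ξ : Fib A u) with hv
  have hvV : v ∈ Vert A u := (C.Γ u ξ).2
  have hH : ξ - v ∈ Horiz C u := sub_Γ_mem_horiz C ξ
  have h1 : ξ - v = 0 := by
    refine g.nondeg_horizontal u _ hH fun ζ hζ ↦ ?_
    rw [map_sub, LinearMap.sub_apply, hξ, g.symm u v ζ, g.mixed u ζ hζ v hvV, sub_zero]
  have h2 : v = 0 := by
    refine g.nondeg_vertical u _ hvV fun ζ hζ ↦ ?_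
    have h3 : v = ξ - (ξ - v) := by abel
    rw [h3, map_sub, LinearMap.sub_apply, hξ, g.mixed u _ hH ζ hζ, sub_zero]
  rw [h2, sub_zero] at h1
  exact h1

/-- A smooth frame of the generalized tangent bundle over `O`. -/
structure IsSmoothFrame (O : Set (TotalSpace P₀ P)) {ι : Type*}
    (B : ι → ∀ u : TotalSpace P₀ P, Fib A u) : Prop where
  smooth : ∀ i, SmoothSec A O (B i)
  exists_basis : ∀ u ∈ O, ∃ b : Module.Basis ι ℝ (Fib A u), ∀ i, b i = B i u

variable (C) in
theorem isSmoothFrame_adapted [FiniteDimensional ℝ EM] [T2Space M] [T2Space N]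
    {p r : ℕ} {U : Set M} {e : Fin r → ∀ x, P x} {W : Set N} {t : Fin p → ∀ y, F y}
    (hU : IsOpen U) (hW : IsOpen W)
    (he : IsLocalFrameOn 𝓘(ℝ, EM) P₀ ∞ e U) (ht : IsLocalFrameOn 𝓘(ℝ, EM) F₀ ∞ t W) :
    IsSmoothFrame {u : TotalSpace P₀ P | u.proj ∈ U ∧ h u.proj ∈ W}
      (Sum.elim (adaptedH C t) (adaptedV A e)) where
  smooth := by
    rintro (α | a)
    · exact (smoothSec_horLift C (ht.contMDiffOn α) hW).mono fun u hu ↦ hu.2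
    · exact (smoothSec_vertLift (he.contMDiffOn a) hU).mono fun u hu ↦ hu.1
  exists_basis u hu := by
    refine ⟨adaptedBasis C he ht hu.1 hu.2, ?_⟩
    rintro (α | a)
    · exact adaptedBasis_inl C he ht hu.1 hu.2 α
    · exact adaptedBasis_inr C he ht hu.1 hu.2 a

theorem isOpen_adaptedDomain {U : Set M} {W : Set N} (hU : IsOpen U) (hW : IsOpen W) :
    IsOpen {u : TotalSpace P₀ P | u.proj ∈ U ∧ h u.proj ∈ W} :=
  (hU.preimage (FiberBundle.continuous_proj P₀ P)).inter
    (hW.preimage (h.continuous.comp (FiberBundle.continuous_proj P₀ P)))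

section Frame

variable {O : Set (TotalSpace P₀ P)} {ι : Type*} [Fintype ι] [DecidableEq ι]
  {B : ι → ∀ u : TotalSpace P₀ P, Fib A u} {u : TotalSpace P₀ P}

theorem IsSmoothFrame.eq_zero (hB : IsSmoothFrame O B) (g : PseudoMetric C) (hu : u ∈ O)
    {ξ : Fib A u} (hξ : ∀ i, g.G u ξ (B i u) = 0) : ξ = 0 := by
  obtain ⟨b, hb⟩ := hB.exists_basis u hu
  refine g.eq_zero_of_forall fun ζ ↦ ?_
  rw [← b.sum_repr ζ, map_sum]
  refine Finset.sum_eq_zero fun i _ ↦ ?_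
  rw [map_smul, hb, hξ, smul_zero]

theorem IsSmoothFrame.ext (hB : IsSmoothFrame O B) (g : PseudoMetric C) (hu : u ∈ O)
    {ξ ζ : Fib A u} (hξ : ∀ i, g.G u ξ (B i u) = g.G u ζ (B i u)) : ξ = ζ := by
  rw [← sub_eq_zero]
  refine hB.eq_zero g hu fun i ↦ ?_
  rw [map_sub, LinearMap.sub_apply, hξ, sub_self]

theorem IsSmoothFrame.det_ne_zero (hB : IsSmoothFrame O B) (g : PseudoMetric C) (hu : u ∈ O) :
    (gram (g.G u) fun i ↦ B i u).det ≠ 0 := by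
  obtain ⟨b, hb⟩ := hB.exists_basis u hu
  refine gram_det_ne_zero _ ?_ fun c hc ↦ hB.eq_zero g hu hc
  simpa only [← hb] using b.linearIndependent

theorem IsSmoothFrame.gramDual_eq (hB : IsSmoothFrame O B) (g : PseudoMetric C) (hu : u ∈ O)
    (ξ : Fib A u) : gramDual (g.G u) (fun i ↦ B i u) (fun i ↦ g.G u ξ (B i u)) = ξ :=
  hB.ext g hu fun i ↦ apply_gramDual _ (hB.det_ne_zero g hu) _ i

theorem IsSmoothFrame.contMDiffOn_coeff (hB : IsSmoothFrame O B) (g : PseudoMetric C)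
    {O' : Set (TotalSpace P₀ P)} (hO' : IsOpen O') (hO'O : O' ⊆ O)
    {c : ι → TotalSpace P₀ P → ℝ}
    (hc : ∀ j, ContMDiffOn (𝓘(ℝ, EM).prod 𝓘(ℝ, P₀)) 𝓘(ℝ, ℝ) ∞ (c j) O') (i : ι) :
    ContMDiffOn (𝓘(ℝ, EM).prod 𝓘(ℝ, P₀)) 𝓘(ℝ, ℝ) ∞
      (fun v ↦ ∑ j, c j v * (gram (g.G v) fun k ↦ B k v)⁻¹ j i) O' := by
  refine contMDiffOn_finsetSum fun j _ ↦ (hc j).mul ?_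
  refine contMDiffOn_matrix_inv (fun k l ↦ ?_) (fun v hv ↦ hB.det_ne_zero g (hO'O hv)) j i
  exact g.smooth O' hO' _ _ ((hB.smooth k).mono hO'O) ((hB.smooth l).mono hO'O)

/-- A section is smooth as soon as its pairings with the members of a frame are smooth. -/
theorem IsSmoothFrame.smoothSec (hB : IsSmoothFrame O B) (g : PseudoMetric C)
    {O' : Set (TotalSpace P₀ P)} (hO' : IsOpen O') (hO'O : O' ⊆ O)
    {X : ∀ u : TotalSpace P₀ P, Fib A u}
    (hX : ∀ j, ContMDiffOn (𝓘(ℝ, EM).prod 𝓘(ℝ, P₀)) 𝓘(ℝ, ℝ) ∞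
      (fun v ↦ g.G v (X v) (B j v)) O') : SmoothSec A O' X := by
  have h1 (i) := ((hB.smooth i).mono hO'O).smul (hB.contMDiffOn_coeff g hO' hO'O hX i)
  have h2 := SmoothSec.sum Finset.univ fun i _ ↦ h1 i
  exact h2.congr fun v hv ↦ (hB.gramDual_eq g (hO'O hv) (X v)).symm

/-- The coefficients of a smooth section in a smooth frame are smooth: they are combinations of its
pairings with the frame, with the inverse Gram matrix as coefficients. -/
theorem IsSmoothFrame.exists_coeff (hB : IsSmoothFrame O B) (g : PseudoMetric C)
    {O' : Set (TotalSpace P₀ P)} (hO' : IsOpen O') (hO'O : O' ⊆ O)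
    {X : ∀ u : TotalSpace P₀ P, Fib A u} (hX : SmoothSec A O' X) :
    ∃ f : ι → TotalSpace P₀ P → ℝ,
      (∀ i, ContMDiffOn (𝓘(ℝ, EM).prod 𝓘(ℝ, P₀)) 𝓘(ℝ, ℝ) ∞ (f i) O') ∧
        ∀ v ∈ O', X v = ∑ i, f i v • B i v :=
  ⟨_, fun i ↦ hB.contMDiffOn_coeff g hO' hO'O
    (fun j ↦ g.smooth _ hO' _ _ hX ((hB.smooth j).mono hO'O)) i,
    fun v hv ↦ (hB.gramDual_eq g (hO'O hv) (X v)).symm⟩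

/-- A pairing identity `G(ζ, τ) = X(G(σ, τ)) - G(σ, D_X τ)` at a point holds for all smooth `τ` as
soon as it holds for the members of a frame. -/
theorem IsSmoothFrame.pairing (hB : IsSmoothFrame O B) (hO : IsOpen O) (g : PseudoMetric C)
    (Δ : DConnection C) (hu : u ∈ O) {O' : Set (TotalSpace P₀ P)} (hO' : IsOpen O') (hu' : u ∈ O')
    {σ τ : ∀ u : TotalSpace P₀ P, Fib A u} (hσ : SmoothSec A O' σ) (hτ : SmoothSec A O' τ)
    {ξ ζ : Fib A u}
    (hζ : ∀ j, g.G u ζ (B j u) =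
      deriv A (fun v ↦ g.G v (σ v) (B j v)) ξ - g.G u (σ u) (Δ.D (B j) u ξ)) :
    g.G u ζ (τ u) = deriv A (fun v ↦ g.G v (σ v) (τ v)) ξ - g.G u (σ u) (Δ.D τ u ξ) := by
  have hQ : IsOpen (O ∩ O') := hO.inter hO'
  have huQ : u ∈ O ∩ O' := ⟨hu, hu'⟩
  have hBQ (i) : SmoothSec A (O ∩ O') (B i) := (hB.smooth i).mono inter_subset_left
  have hσQ : SmoothSec A (O ∩ O') σ := hσ.mono inter_subset_right
  have hτQ : SmoothSec A (O ∩ O') τ := hτ.mono inter_subset_right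
  obtain ⟨f, hf, hτf⟩ := hB.exists_coeff g hQ inter_subset_left hτQ
  have hdiff {φ : TotalSpace P₀ P → ℝ}
      (hφ : ContMDiffOn (𝓘(ℝ, EM).prod 𝓘(ℝ, P₀)) 𝓘(ℝ, ℝ) ∞ φ (O ∩ O')) :
      MDifferentiableAt (𝓘(ℝ, EM).prod 𝓘(ℝ, P₀)) 𝓘(ℝ, ℝ) φ u :=
    (hφ.contMDiffAt (hQ.mem_nhds huQ)).mdifferentiableAt (by simp)
  have h1 : Δ.D τ u ξ = ∑ i, (f i u • Δ.D (B i) u ξ + deriv A (f i) ξ • B i u) := by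
    rw [Δ.congr hQ hτQ hτf huQ, Δ.D_sum_smul hQ _ hf hBQ huQ]
  have h2 : deriv A (fun v ↦ g.G v (σ v) (τ v)) ξ =
      ∑ i, (f i u * deriv A (fun v ↦ g.G v (σ v) (B i v)) ξ
        + g.G u (σ u) (B i u) * deriv A (f i) ξ) := by
    rw [← deriv_sum_mul Finset.univ (fun i ↦ hdiff (hf i))
      (fun i ↦ hdiff (g.smooth _ hQ _ _ hσQ (hBQ i)))]
    refine deriv_congr ?_ ξ
    filter_upwards [hQ.mem_nhds huQ] with v hv
    rw [hτf v hv, map_sum]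
    simp
  rw [h1, h2, hτf u huQ]
  exact pairing_sum (g.G u) _ _ _ _ hζ

end Frame

end Frames

/-! ### The metric adjoint of a distinguished connection -/

section Adjoint

variable {EM : Type*} [NormedAddCommGroup EM] [NormedSpace ℝ EM]
  {M : Type*} [TopologicalSpace M] [ChartedSpace EM M] [IsManifold 𝓘(ℝ, EM) ∞ M]
  {N : Type*} [TopologicalSpace N] [ChartedSpace EM N] [IsManifold 𝓘(ℝ, EM) ∞ N]
  {F₀ : Type*} [NormedAddCommGroup F₀] [NormedSpace ℝ F₀]
  {F : N → Type*} [TopologicalSpace (TotalSpace F₀ F)]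
  [∀ y, AddCommGroup (F y)] [∀ y, Module ℝ (F y)] [∀ y, TopologicalSpace (F y)]
  [FiberBundle F₀ F] [VectorBundle ℝ F₀ F] [ContMDiffVectorBundle ∞ F₀ F 𝓘(ℝ, EM)]
  {h : M ≃ₘ^∞⟮𝓘(ℝ, EM), 𝓘(ℝ, EM)⟯ N} {η : N ≃ₘ^∞⟮𝓘(ℝ, EM), 𝓘(ℝ, EM)⟯ M}
  {P₀ : Type*} [NormedAddCommGroup P₀] [NormedSpace ℝ P₀]
  {P : M → Type*} [TopologicalSpace (TotalSpace P₀ P)]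
  [∀ x, AddCommGroup (P x)] [∀ x, Module ℝ (P x)] [∀ x, TopologicalSpace (P x)]
  [FiberBundle P₀ P] [VectorBundle ℝ P₀ P] [ContMDiffVectorBundle ∞ P₀ P 𝓘(ℝ, EM)]
  {A : GenLieAlgebroid F₀ F h η} {C : Connection P₀ P A}

theorem PseudoMetric.mem_horiz (g : PseudoMetric C) {u : TotalSpace P₀ P} {ξ : Fib A u}
    (hξ : ∀ ζ ∈ Vert A u, g.G u ξ ζ = 0) : ξ ∈ Horiz C u := by
  have hH := sub_Γ_mem_horiz C ξ
  have h1 : (C.Γ u ξ : Fib A u) = 0 := by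
    refine g.nondeg_vertical u _ (C.Γ u ξ).2 fun ζ hζ ↦ ?_
    have h2 := g.mixed u _ hH ζ hζ
    rw [map_sub, LinearMap.sub_apply, hξ ζ hζ, zero_sub, neg_eq_zero] at h2
    exact h2
  rwa [h1, sub_zero] at hH

theorem PseudoMetric.mem_vert (g : PseudoMetric C) {u : TotalSpace P₀ P} {ξ : Fib A u}
    (hξ : ∀ ζ ∈ Horiz C u, g.G u ξ ζ = 0) : ξ ∈ Vert A u := by
  have h1 : ξ - (C.Γ u ξ : Fib A u) = 0 := by
    refine g.nondeg_horizontal u _ (sub_Γ_mem_horiz C ξ) fun ζ hζ ↦ ?_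
    rw [map_sub, LinearMap.sub_apply, hξ ζ hζ, g.symm, g.mixed u ζ hζ _ (C.Γ u ξ).2, sub_zero]
  rw [sub_eq_zero.1 h1]
  exact (C.Γ u ξ).2

section LocalFrame

variable [FiniteDimensional ℝ F₀] [FiniteDimensional ℝ P₀]

variable (C) in
/-- The adapted base near `u₀` of the frames that the preferred trivializations of `F` and of `P`
induce. -/
def frameAt (u₀ : TotalSpace P₀ P) :
    Fin (Module.finrank ℝ F₀) ⊕ Fin (Module.finrank ℝ P₀) → ∀ u : TotalSpace P₀ P, Fib A u :=
  Sum.elim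
    (adaptedH C ((trivializationAt F₀ F (h u₀.proj)).localFrame (Module.finBasis ℝ F₀)))
    (adaptedV A ((trivializationAt P₀ P u₀.proj).localFrame (Module.finBasis ℝ P₀)))

/-- The domain of `frameAt`. -/
def frameDomain (F₀ : Type*) [NormedAddCommGroup F₀] [NormedSpace ℝ F₀]
    (F : N → Type*) [TopologicalSpace (TotalSpace F₀ F)] [∀ y, TopologicalSpace (F y)]
    [FiberBundle F₀ F] (h : M ≃ₘ^∞⟮𝓘(ℝ, EM), 𝓘(ℝ, EM)⟯ N)
    (u₀ : TotalSpace P₀ P) : Set (TotalSpace P₀ P) :=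
  {u | u.proj ∈ (trivializationAt P₀ P u₀.proj).baseSet ∧
    h u.proj ∈ (trivializationAt F₀ F (h u₀.proj)).baseSet}

theorem isOpen_frameDomain (u₀ : TotalSpace P₀ P) : IsOpen (frameDomain F₀ F h u₀) :=
  isOpen_adaptedDomain (trivializationAt P₀ P u₀.proj).open_baseSet
    (trivializationAt F₀ F (h u₀.proj)).open_baseSet

theorem mem_frameDomain (u₀ : TotalSpace P₀ P) : u₀ ∈ frameDomain F₀ F h u₀ :=
  ⟨mem_baseSet_trivializationAt P₀ P u₀.proj, mem_baseSet_trivializationAt F₀ F (h u₀.proj)⟩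

variable [FiniteDimensional ℝ EM] [T2Space M] [T2Space N]

theorem isSmoothFrame_frameAt (u₀ : TotalSpace P₀ P) :
    IsSmoothFrame (frameDomain F₀ F h u₀) (frameAt C u₀) :=
  isSmoothFrame_adapted C (trivializationAt P₀ P u₀.proj).open_baseSet
    (trivializationAt F₀ F (h u₀.proj)).open_baseSet
    (Trivialization.isLocalFrameOn_localFrame_baseSet 𝓘(ℝ, EM) ∞ _ _)
    (Trivialization.isLocalFrameOn_localFrame_baseSet 𝓘(ℝ, EM) ∞ _ _)

theorem exists_smoothSec_apply_eq (C : Connection P₀ P A) {u : TotalSpace P₀ P} (ζ : Fib A u) :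
    ∃ τ : ∀ v : TotalSpace P₀ P, Fib A v, SmoothSec A (frameDomain F₀ F h u) τ ∧ τ u = ζ := by
  have hB := isSmoothFrame_frameAt (C := C) u
  obtain ⟨b, hb⟩ := hB.exists_basis u (mem_frameDomain u)
  refine ⟨_, .sum Finset.univ fun i _ ↦ (hB.smooth i).smul
    (contMDiffOn_const (c := b.repr ζ i)), ?_⟩
  simp only [← hb]
  exact b.sum_repr ζ

theorem exists_smoothSec_vert (C : Connection P₀ P A) {u : TotalSpace P₀ P} {ζ : Fib A u} (hζ : ζ ∈ Vert A u) :
    ∃ τ : ∀ v : TotalSpace P₀ P, Fib A v, SmoothSec A (frameDomain F₀ F h u) τ ∧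
      (∀ v, τ v ∈ Vert A v) ∧ τ u = ζ := by
  obtain ⟨τ, hτ, hτu⟩ := exists_smoothSec_apply_eq C ζ
  refine ⟨_, C.smooth _ (isOpen_frameDomain u) τ hτ, fun v ↦ (C.Γ v (τ v)).2, ?_⟩
  rw [hτu]
  exact congrArg Subtype.val (C.split u ⟨ζ, hζ⟩)

variable (C) in
theorem exists_smoothSec_horiz {u : TotalSpace P₀ P} {ζ : Fib A u} (hζ : ζ ∈ Horiz C u) :
    ∃ τ : ∀ v : TotalSpace P₀ P, Fib A v, SmoothSec A (frameDomain F₀ F h u) τ ∧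
      (∀ v, τ v ∈ Horiz C v) ∧ τ u = ζ := by
  obtain ⟨τ, hτ, hτu⟩ := exists_smoothSec_apply_eq C ζ
  refine ⟨_, hτ.sub (C.smooth _ (isOpen_frameDomain u) τ hτ),
    fun v ↦ sub_Γ_mem_horiz C (τ v), ?_⟩
  have h1 : C.Γ u ζ = 0 := hζ
  rw [hτu, h1]
  exact sub_zero ζ

variable (g : PseudoMetric C) (Δ : DConnection C)

/-- The metric adjoint `Δ*` of a distinguished connection: `Δ*_ξ σ` is the vector with
`G(Δ*_ξ σ, τ) = ξ (G(σ, τ)) - G(σ, Δ_ξ τ)` for all `τ`.  It is defined by imposing this for the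
members `τ` of a frame chosen at the point. -/
def adjointD (σ : ∀ u : TotalSpace P₀ P, Fib A u) (u : TotalSpace P₀ P) :
    Fib A u →ₗ[ℝ] Fib A u where
  toFun ξ := gramDual (g.G u) (fun i ↦ frameAt C u i u) fun j ↦
    deriv A (fun v ↦ g.G v (σ v) (frameAt C u j v)) ξ - g.G u (σ u) (Δ.D (frameAt C u j) u ξ)
  map_add' ξ ζ := by
    rw [← gramDual_add]
    congr 1
    funext j
    simp only [← derivLinear_apply, map_add, Pi.add_apply]
    ring
  map_smul' c ξ := by
    rw [RingHom.id_apply, ← gramDual_smul]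
    congr 1
    funext j
    simp only [← derivLinear_apply, map_smul, Pi.smul_apply, smul_eq_mul]
    ring

variable {g Δ} in
theorem adjointD_frameAt (σ : ∀ u : TotalSpace P₀ P, Fib A u) (u : TotalSpace P₀ P) (ξ : Fib A u)
    (j) : g.G u (adjointD g Δ σ u ξ) (frameAt C u j u) =
      deriv A (fun v ↦ g.G v (σ v) (frameAt C u j v)) ξ
        - g.G u (σ u) (Δ.D (frameAt C u j) u ξ) :=
  apply_gramDual (g.G u) ((isSmoothFrame_frameAt u).det_ne_zero g (mem_frameDomain u)) _ j

variable {O : Set (TotalSpace P₀ P)} {σ τ : ∀ u : TotalSpace P₀ P, Fib A u}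
  {u : TotalSpace P₀ P}

theorem adjointD_pairing (hO : IsOpen O) (hσ : SmoothSec A O σ) (hτ : SmoothSec A O τ)
    (hu : u ∈ O) (ξ : Fib A u) :
    g.G u (adjointD g Δ σ u ξ) (τ u) =
      deriv A (fun v ↦ g.G v (σ v) (τ v)) ξ - g.G u (σ u) (Δ.D τ u ξ) :=
  (isSmoothFrame_frameAt u).pairing (isOpen_frameDomain u) g Δ (mem_frameDomain u) hO hu hσ hτ
    (adjointD_frameAt σ u ξ)

theorem mdifferentiableAt_pairing_frameAt (hO : IsOpen O) (hσ : SmoothSec A O σ) (hu : u ∈ O)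
    (j) : MDifferentiableAt (𝓘(ℝ, EM).prod 𝓘(ℝ, P₀)) 𝓘(ℝ, ℝ)
      (fun v ↦ g.G v (σ v) (frameAt C u j v)) u := by
  have hQ : IsOpen (O ∩ frameDomain F₀ F h u) := hO.inter (isOpen_frameDomain u)
  have h1 := g.smooth _ hQ _ _ (hσ.mono inter_subset_left)
    (((isSmoothFrame_frameAt (C := C) u).smooth j).mono inter_subset_right)
  exact (h1.contMDiffAt (hQ.mem_nhds ⟨hu, mem_frameDomain u⟩)).mdifferentiableAt (by simp)

theorem adjointD_add (hO : IsOpen O) (hσ : SmoothSec A O σ) (hτ : SmoothSec A O τ) (hu : u ∈ O)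
    (ξ : Fib A u) : adjointD g Δ (fun v ↦ σ v + τ v) u ξ
      = adjointD g Δ σ u ξ + adjointD g Δ τ u ξ := by
  refine (isSmoothFrame_frameAt (C := C) u).ext g (mem_frameDomain u) fun j ↦ ?_
  rw [map_add, LinearMap.add_apply, adjointD_frameAt, adjointD_frameAt, adjointD_frameAt]
  simp only [map_add, LinearMap.add_apply]
  rw [deriv_add (mdifferentiableAt_pairing_frameAt g hO hσ hu j)
    (mdifferentiableAt_pairing_frameAt g hO hτ hu j)]
  ring

theorem adjointD_leibniz (hO : IsOpen O) {f : TotalSpace P₀ P → ℝ}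
    (hf : ContMDiffOn (𝓘(ℝ, EM).prod 𝓘(ℝ, P₀)) 𝓘(ℝ, ℝ) ∞ f O) (hσ : SmoothSec A O σ)
    (hu : u ∈ O) (ξ : Fib A u) : adjointD g Δ (fun v ↦ f v • σ v) u ξ
      = f u • adjointD g Δ σ u ξ + deriv A f ξ • σ u := by
  refine (isSmoothFrame_frameAt (C := C) u).ext g (mem_frameDomain u) fun j ↦ ?_
  rw [map_add, LinearMap.add_apply, map_smul, map_smul, LinearMap.smul_apply,
    LinearMap.smul_apply, adjointD_frameAt, adjointD_frameAt]
  simp only [map_smul, LinearMap.smul_apply, smul_eq_mul]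
  rw [deriv_mul ((hf.contMDiffAt (hO.mem_nhds hu)).mdifferentiableAt (by simp))
    (mdifferentiableAt_pairing_frameAt g hO hσ hu j)]
  ring

theorem smoothSec_adjointD (hO : IsOpen O) {X : ∀ u : TotalSpace P₀ P, Fib A u}
    (hX : SmoothSec A O X) (hσ : SmoothSec A O σ) :
    SmoothSec A O (fun v ↦ adjointD g Δ σ v (X v)) := by
  refine SmoothSec.of_locally fun u hu ↦
    ⟨frameDomain F₀ F h u, isOpen_frameDomain u, mem_frameDomain u, ?_⟩
  have hB := isSmoothFrame_frameAt (C := C) u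
  have hQ : IsOpen (O ∩ frameDomain F₀ F h u) := hO.inter (isOpen_frameDomain u)
  have hσQ := hσ.mono (inter_subset_left : O ∩ frameDomain F₀ F h u ⊆ O)
  have hXQ := hX.mono (inter_subset_left : O ∩ frameDomain F₀ F h u ⊆ O)
  refine hB.smoothSec g hQ inter_subset_right fun j ↦ ?_
  have hBQ := (hB.smooth j).mono (inter_subset_right : O ∩ frameDomain F₀ F h u ⊆ _)
  refine ((contMDiffOn_deriv hQ (g.smooth _ hQ _ _ hσQ hBQ) hXQ).sub
    (g.smooth _ hQ _ _ hσQ (Δ.smooth _ hQ _ _ hXQ hBQ))).congr fun v hv ↦ ?_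
  exact adjointD_pairing g Δ hQ hσQ hBQ hv (X v)

theorem adjointD_mem_horiz (hO : IsOpen O) (hσ : SmoothSec A O σ) (hσ' : ∀ v ∈ O, σ v ∈ Horiz C v)
    (hu : u ∈ O) (ξ : Fib A u) : adjointD g Δ σ u ξ ∈ Horiz C u := by
  refine g.mem_horiz fun ζ hζ ↦ ?_
  obtain ⟨τ, hτ, hτV, rfl⟩ := exists_smoothSec_vert C hζ
  have hQ : IsOpen (O ∩ frameDomain F₀ F h u) := hO.inter (isOpen_frameDomain u)
  have huQ : u ∈ O ∩ frameDomain F₀ F h u := ⟨hu, mem_frameDomain u⟩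
  rw [adjointD_pairing g Δ hQ (hσ.mono inter_subset_left) (hτ.mono inter_subset_right) huQ,
    g.mixed u _ (hσ' u hu) _
      (Δ.vertical _ (isOpen_frameDomain u) τ hτ (fun v _ ↦ hτV v) u (mem_frameDomain u) ξ),
    deriv_congr (f' := fun _ ↦ 0), deriv_const, sub_zero]
  filter_upwards [hO.mem_nhds hu] with v hv using g.mixed v _ (hσ' v hv) _ (hτV v)

theorem adjointD_mem_vert (hO : IsOpen O) (hσ : SmoothSec A O σ) (hσ' : ∀ v ∈ O, σ v ∈ Vert A v)
    (hu : u ∈ O) (ξ : Fib A u) : adjointD g Δ σ u ξ ∈ Vert A u := by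
  refine g.mem_vert fun ζ hζ ↦ ?_
  obtain ⟨τ, hτ, hτH, rfl⟩ := exists_smoothSec_horiz C hζ
  have hQ : IsOpen (O ∩ frameDomain F₀ F h u) := hO.inter (isOpen_frameDomain u)
  have huQ : u ∈ O ∩ frameDomain F₀ F h u := ⟨hu, mem_frameDomain u⟩
  rw [adjointD_pairing g Δ hQ (hσ.mono inter_subset_left) (hτ.mono inter_subset_right) huQ,
    g.symm u (σ u), g.mixed u _
      (Δ.horizontal _ (isOpen_frameDomain u) τ hτ (fun v _ ↦ hτH v) u (mem_frameDomain u) ξ) _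
      (hσ' u hu),
    deriv_congr (f' := fun _ ↦ 0), deriv_const, sub_zero]
  filter_upwards [hO.mem_nhds hu] with v hv
  rw [g.symm, g.mixed v _ (hτH v) _ (hσ' v hv)]

/-- The average of a distinguished connection and its metric adjoint. -/
def metrization : DConnection C where
  D σ u := (1 / 2 : ℝ) • Δ.D σ u + (1 / 2 : ℝ) • adjointD g Δ σ u
  add O hO σ τ hσ hτ u hu ξ := by
    simp only [LinearMap.add_apply, LinearMap.smul_apply]
    rw [Δ.add O hO σ τ hσ hτ u hu ξ, adjointD_add g Δ hO hσ hτ hu ξ]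
    module
  leibniz O hO f σ hf hσ u hu ξ := by
    simp only [LinearMap.add_apply, LinearMap.smul_apply]
    rw [Δ.leibniz O hO f σ hf hσ u hu ξ, adjointD_leibniz g Δ hO hf hσ hu ξ]
    module
  smooth O hO X σ hX hσ :=
    (Δ.smooth O hO X σ hX hσ).smul_add_smul contMDiffOn_const contMDiffOn_const
      (smoothSec_adjointD g Δ hO hX hσ)
  horizontal O hO σ hσ hσ' u hu ξ :=
    Submodule.add_mem _ (Submodule.smul_mem _ _ (Δ.horizontal O hO σ hσ hσ' u hu ξ))
      (Submodule.smul_mem _ _ (adjointD_mem_horiz g Δ hO hσ hσ' hu ξ))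
  vertical O hO σ hσ hσ' u hu ξ :=
    Submodule.add_mem _ (Submodule.smul_mem _ _ (Δ.vertical O hO σ hσ hσ' u hu ξ))
      (Submodule.smul_mem _ _ (adjointD_mem_vert g Δ hO hσ hσ' hu ξ))

theorem metrization_apply (σ : ∀ u : TotalSpace P₀ P, Fib A u) (u : TotalSpace P₀ P)
    (ξ : Fib A u) : (metrization g Δ).D σ u ξ =
      (1 / 2 : ℝ) • Δ.D σ u ξ + (1 / 2 : ℝ) • adjointD g Δ σ u ξ :=
  rfl

theorem isParallel_metrization : IsParallel (metrization g Δ) g := by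
  intro O hO σ τ hσ hτ u hu ξ
  have h1 := adjointD_pairing g Δ hO hσ hτ hu ξ
  have h2 := adjointD_pairing g Δ hO hτ hσ hu ξ
  have h3 : (fun v ↦ g.G v (τ v) (σ v)) = fun v ↦ g.G v (σ v) (τ v) :=
    funext fun v ↦ g.symm v _ _
  rw [h3, g.symm u _ (σ u), g.symm u (τ u)] at h2
  rw [metrization_apply, metrization_apply]
  simp only [map_add, map_smul, LinearMap.add_apply, LinearMap.smul_apply, smul_eq_mul, h1, h2]
  ring

end LocalFrame

end Adjoint

/-! ### Components in adapted bases -/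

section ComponentFormulas

variable {EM : Type*} [NormedAddCommGroup EM] [NormedSpace ℝ EM]
  {M : Type*} [TopologicalSpace M] [ChartedSpace EM M] [IsManifold 𝓘(ℝ, EM) ∞ M]
  {N : Type*} [TopologicalSpace N] [ChartedSpace EM N] [IsManifold 𝓘(ℝ, EM) ∞ N]
  {F₀ : Type*} [NormedAddCommGroup F₀] [NormedSpace ℝ F₀]
  {F : N → Type*} [TopologicalSpace (TotalSpace F₀ F)]
  [∀ y, AddCommGroup (F y)] [∀ y, Module ℝ (F y)] [∀ y, TopologicalSpace (F y)]
  [FiberBundle F₀ F] [VectorBundle ℝ F₀ F] [ContMDiffVectorBundle ∞ F₀ F 𝓘(ℝ, EM)]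
  {h : M ≃ₘ^∞⟮𝓘(ℝ, EM), 𝓘(ℝ, EM)⟯ N} {η : N ≃ₘ^∞⟮𝓘(ℝ, EM), 𝓘(ℝ, EM)⟯ M}
  {P₀ : Type*} [NormedAddCommGroup P₀] [NormedSpace ℝ P₀]
  {P : M → Type*} [TopologicalSpace (TotalSpace P₀ P)]
  [∀ x, AddCommGroup (P x)] [∀ x, Module ℝ (P x)] [∀ x, TopologicalSpace (P x)]
  [FiberBundle P₀ P] [VectorBundle ℝ P₀ P] [ContMDiffVectorBundle ∞ P₀ P 𝓘(ℝ, EM)]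
  {A : GenLieAlgebroid F₀ F h η} {C : Connection P₀ P A}
  {p r : ℕ} {U : Set M} {e : Fin r → ∀ x, P x} {W : Set N} {t : Fin p → ∀ y, F y}
  {u : TotalSpace P₀ P}

theorem exists_eq_sum_adaptedH (ht : IsLocalFrameOn 𝓘(ℝ, EM) F₀ ∞ t W) (hu : h u.proj ∈ W)
    {ξ : Fib A u} (hξ : ξ ∈ Horiz C u) : ∃ c : Fin p → ℝ, ξ = ∑ α, c α • adaptedH C t α u := by
  refine ⟨(ht.toBasisAt hu).repr ξ.1.1, ?_⟩
  have h1 := congrArg (horLiftₗ C u) ((ht.toBasisAt hu).sum_repr ξ.1.1)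
  rw [map_sum] at h1
  refine (horLift_eq_of_mem_horiz C hξ).symm.trans (h1.symm.trans ?_)
  refine Finset.sum_congr rfl fun α _ ↦ ?_
  rw [map_smul, IsLocalFrameOn.toBasisAt_coe]
  rfl

theorem exists_eq_sum_adaptedV (he : IsLocalFrameOn 𝓘(ℝ, EM) P₀ ∞ e U) (hu : u.proj ∈ U)
    {ξ : Fib A u} (hξ : ξ ∈ Vert A u) : ∃ c : Fin r → ℝ, ξ = ∑ a, c a • adaptedV A e a u := by
  obtain ⟨ε, rfl⟩ := exists_vertLift_eq hξ
  refine ⟨(he.toBasisAt hu).repr ε, ?_⟩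
  have h1 := congrArg (vertLiftₗ A u) ((he.toBasisAt hu).sum_repr ε)
  rw [map_sum] at h1
  refine h1.symm.trans (Finset.sum_congr rfl fun a _ ↦ ?_)
  rw [map_smul, IsLocalFrameOn.toBasisAt_coe]
  rfl

variable [FiniteDimensional ℝ EM] [T2Space M] [T2Space N]

/-- The components of a distinguished connection exist in every adapted base, because it preserves
the horizontal and the vertical subbundle. -/
theorem exists_isComponents (Δ : DConnection C) (hU : IsOpen U) (hW : IsOpen W)
    (he : IsLocalFrameOn 𝓘(ℝ, EM) P₀ ∞ e U) (ht : IsLocalFrameOn 𝓘(ℝ, EM) F₀ ∞ t W) :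
    ∃ K, IsComponents Δ U e W t K := by
  classical
  have hO := isOpen_adaptedDomain (P₀ := P₀) (P := P) (h := h) hU hW
  have hB := isSmoothFrame_adapted C hU hW he ht
  -- outside the domain of the adapted base nothing is asked, and zero serves as component
  have hH : ∀ u : TotalSpace P₀ P, ∀ β (ξ : Fib A u), ∃ c : Fin p → ℝ,
      u.proj ∈ U → h u.proj ∈ W → Δ.D (adaptedH C t β) u ξ = ∑ α, c α • adaptedH C t α u := by
    intro u β ξ
    by_cases hu : u.proj ∈ U ∧ h u.proj ∈ W
    · obtain ⟨c, hc⟩ := exists_eq_sum_adaptedH ht hu.2 (Δ.horizontal _ hO _ (hB.smooth (.inl β))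
        (fun v _ ↦ horLift_mem_horiz C v _) u hu ξ)
      exact ⟨c, fun _ _ ↦ hc⟩
    · exact ⟨0, fun h1 h2 ↦ absurd ⟨h1, h2⟩ hu⟩
  have hV : ∀ u : TotalSpace P₀ P, ∀ a (ξ : Fib A u), ∃ c : Fin r → ℝ,
      u.proj ∈ U → h u.proj ∈ W → Δ.D (adaptedV A e a) u ξ = ∑ b, c b • adaptedV A e b u := by
    intro u a ξ
    by_cases hu : u.proj ∈ U ∧ h u.proj ∈ W
    · obtain ⟨c, hc⟩ := exists_eq_sum_adaptedV he hu.1 (Δ.vertical _ hO _ (hB.smooth (.inr a))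
        (fun v _ ↦ vertLift_mem_vert v _) u hu ξ)
      exact ⟨c, fun _ _ ↦ hc⟩
    · exact ⟨0, fun h1 h2 ↦ absurd ⟨h1, h2⟩ hu⟩
  choose cH hcH using hH
  choose cV hcV using hV
  refine ⟨⟨fun α β γ u ↦ cH u β (adaptedH C t γ u) α, fun a b γ u ↦ cV u a (adaptedH C t γ u) b,
    fun α β c u ↦ cH u β (adaptedV A e c u) α, fun a b c u ↦ cV u a (adaptedV A e c u) b⟩, ?_⟩
  exact fun u hu hu' ↦ ⟨fun β γ ↦ hcH u β _ hu hu', fun a γ ↦ hcV u a _ hu hu',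
    fun β c ↦ hcH u β _ hu hu', fun a c ↦ hcV u a _ hu hu'⟩

variable [FiniteDimensional ℝ F₀] [FiniteDimensional ℝ P₀] (g : PseudoMetric C)
  (Δ : DConnection C)

/-- The coefficients of the averaged connection on a subbundle that both it and `Δ` preserve: `S` is
the fibre of the subbundle and `B` a frame of it. -/
theorem metrization_eq_sum {ι : Type*} [Fintype ι] [DecidableEq ι]
    {B : ι → ∀ u : TotalSpace P₀ P, Fib A u} {S : Submodule ℝ (Fib A u)}
    {O : Set (TotalSpace P₀ P)} (hO : IsOpen O) (hu : u ∈ O) (hB : ∀ i, SmoothSec A O (B i))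
    (hind : LinearIndependent ℝ fun i ↦ B i u) (hBS : ∀ i, B i u ∈ S)
    (hgen : ∀ ξ ∈ S, ∃ c : ι → ℝ, ξ = ∑ i, c i • B i u)
    (hnondeg : ∀ ξ ∈ S, (∀ ζ ∈ S, g.G u ξ ζ = 0) → ξ = 0) (ξ : Fib A u)
    (hS : ∀ i, adjointD g Δ (B i) u ξ ∈ S) {k : ι → ι → ℝ}
    (hk : ∀ i, Δ.D (B i) u ξ = ∑ j, k j i • B j u) (i : ι) :
    (metrization g Δ).D (B i) u ξ = ∑ j, (k j i + 1 / 2 * ∑ l,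
      (gram (g.G u) fun i ↦ B i u)⁻¹ j l *
        (deriv A (fun v ↦ gram (g.G v) (fun i ↦ B i v) l i) ξ
          - ∑ m, k m l * gram (g.G u) (fun i ↦ B i u) m i
          - ∑ m, k m i * gram (g.G u) (fun i ↦ B i u) l m)) • B j u := by
  have hsep : ∀ x ∈ S, (∀ i, g.G u x (B i u) = 0) → x = 0 := by
    intro x hx hx'
    refine hnondeg x hx fun ζ hζ ↦ ?_
    obtain ⟨c, rfl⟩ := hgen ζ hζ
    rw [map_sum]
    exact Finset.sum_eq_zero fun i _ ↦ by rw [map_smul, hx', smul_zero]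
  have hdet : (gram (g.G u) fun i ↦ B i u).det ≠ 0 :=
    gram_det_ne_zero _ hind fun c hc ↦
      hsep _ (Submodule.sum_mem _ fun i _ ↦ Submodule.smul_mem _ _ (hBS i)) hc
  have hsum : ∀ (c : ι → ℝ) l, g.G u (B l u) (∑ m, c m • B m u) =
      ∑ m, c m * gram (g.G u) (fun i ↦ B i u) l m := by
    intro c l
    simp [gram]
  refine half_smul_add_eq_sum (g.G u) (g.symm u) hBS hdet hsep (hS i) (hk i) fun l ↦ ?_
  have h1 : (fun v ↦ g.G v (B i v) (B l v)) = fun v ↦ gram (g.G v) (fun i ↦ B i v) l i :=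
    funext fun v ↦ g.symm v _ _
  have h2 : ∀ m, gram (g.G u) (fun i ↦ B i u) i m = gram (g.G u) (fun i ↦ B i u) m i :=
    fun m ↦ g.symm u _ _
  rw [adjointD_pairing g Δ hO (hB i) (hB l) hu, hk, hk, g.symm u _ (B l u), hsum, hsum, h1]
  simp only [h2]
  ring

theorem isComponents_metrization (hU : IsOpen U) (hW : IsOpen W)
    (he : IsLocalFrameOn 𝓘(ℝ, EM) P₀ ∞ e U) (ht : IsLocalFrameOn 𝓘(ℝ, EM) F₀ ∞ t W)
    {K : Components (TotalSpace P₀ P) p r} (hK : IsComponents Δ U e W t K) :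
    IsComponents (metrization g Δ) U e W t (corrected g e t K) := by
  intro u hu hu'
  have hO := isOpen_adaptedDomain (P₀ := P₀) (P := P) (h := h) hU hW
  have hB := isSmoothFrame_adapted C hU hW he ht
  have huO : u ∈ {u : TotalSpace P₀ P | u.proj ∈ U ∧ h u.proj ∈ W} := ⟨hu, hu'⟩
  obtain ⟨hK1, hK2, hK3, hK4⟩ := hK u hu hu'
  have hind := (adaptedBasis C he ht hu hu').linearIndependent
  have hindH : LinearIndependent ℝ fun α ↦ adaptedH C t α u := by
    simpa only [Function.comp_def, adaptedBasis_inl] using hind.comp _ Sum.inl_injective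
  have hindV : LinearIndependent ℝ fun a ↦ adaptedV A e a u := by
    simpa only [Function.comp_def, adaptedBasis_inr] using hind.comp _ Sum.inr_injective
  have hH := fun (ξ : Fib A u) (k : Fin p → Fin p → ℝ) ↦ metrization_eq_sum g Δ (k := k)
    (B := adaptedH C t) hO huO (fun α ↦ hB.smooth (.inl α)) hindH
    (fun α ↦ horLift_mem_horiz C u _) (fun ξ hξ ↦ exists_eq_sum_adaptedH ht hu' hξ)
    (g.nondeg_horizontal u) ξ (fun α ↦ adjointD_mem_horiz g Δ hO (hB.smooth (.inl α))
      (fun v _ ↦ horLift_mem_horiz C v _) huO ξ)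
  have hV := fun (ξ : Fib A u) (k : Fin r → Fin r → ℝ) ↦ metrization_eq_sum g Δ (k := k)
    (B := adaptedV A e) hO huO (fun a ↦ hB.smooth (.inr a)) hindV
    (fun a ↦ vertLift_mem_vert u _) (fun ξ hξ ↦ exists_eq_sum_adaptedV he hu hξ)
    (g.nondeg_vertical u) ξ (fun a ↦ adjointD_mem_vert g Δ hO (hB.smooth (.inr a))
      (fun v _ ↦ vertLift_mem_vert v _) huO ξ)
  refine ⟨fun β γ ↦ ?_, fun a γ ↦ ?_, fun β c ↦ ?_, fun a c ↦ ?_⟩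
  · exact hH _ (fun α β ↦ K.H α β γ u) (fun β ↦ hK1 β γ) β
  · exact hV _ (fun b a ↦ K.H' a b γ u) (fun a ↦ hK2 a γ) a
  · exact hH _ (fun α β ↦ K.V α β c u) (fun β ↦ hK3 β c) β
  · exact hV _ (fun b a ↦ K.V' a b c u) (fun a ↦ hK4 a c) a

end ComponentFormulas

end

end GenTangent

theorem theorem5p3 {m p r : ℕ}
    {M : Type*} [TopologicalSpace M] [T2Space M] [ChartedSpace (EuclideanSpace ℝ (Fin m)) M]
    [IsManifold (𝓡 m) ∞ M]
    {N : Type*} [TopologicalSpace N] [T2Space N] [ChartedSpace (EuclideanSpace ℝ (Fin m)) N]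
    [IsManifold (𝓡 m) ∞ N]
    {E : M → Type*} [TopologicalSpace (TotalSpace (EuclideanSpace ℝ (Fin r)) E)]
    [∀ x, AddCommGroup (E x)] [∀ x, Module ℝ (E x)] [∀ x, TopologicalSpace (E x)]
    [FiberBundle (EuclideanSpace ℝ (Fin r)) E] [VectorBundle ℝ (EuclideanSpace ℝ (Fin r)) E]
    [ContMDiffVectorBundle ∞ (EuclideanSpace ℝ (Fin r)) E (𝓡 m)]
    {F : N → Type*} [TopologicalSpace (TotalSpace (EuclideanSpace ℝ (Fin p)) F)]
    [∀ y, AddCommGroup (F y)] [∀ y, Module ℝ (F y)] [∀ y, TopologicalSpace (F y)]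
    [FiberBundle (EuclideanSpace ℝ (Fin p)) F] [VectorBundle ℝ (EuclideanSpace ℝ (Fin p)) F]
    [ContMDiffVectorBundle ∞ (EuclideanSpace ℝ (Fin p)) F (𝓡 m)]
    (h : M ≃ₘ^∞⟮𝓡 m, 𝓡 m⟯ N) (η : N ≃ₘ^∞⟮𝓡 m, 𝓡 m⟯ M)
    (A : GenTangent.GenLieAlgebroid (EuclideanSpace ℝ (Fin p)) F h η)
    (C : GenTangent.Connection (EuclideanSpace ℝ (Fin r) →L[ℝ] ℝ)
      (fun x ↦ E x →L[ℝ] Bundle.Trivial M ℝ x) A)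
    (D₀ : GenTangent.DConnection C) (g : GenTangent.PseudoMetric C) :
    ∃ D : GenTangent.DConnection C,
      (∀ (U : Set M) (e : Fin r → ∀ x, E x →L[ℝ] Bundle.Trivial M ℝ x)
          (W : Set N) (t : Fin p → ∀ y, F y), IsOpen U → IsOpen W →
          IsLocalFrameOn (𝓡 m) (EuclideanSpace ℝ (Fin r) →L[ℝ] ℝ) ∞ e U →
          IsLocalFrameOn (𝓡 m) (EuclideanSpace ℝ (Fin p)) ∞ t W →
          (∃ K, GenTangent.IsComponents D₀ U e W t K) ∧
          ∀ K, GenTangent.IsComponents D₀ U e W t K →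
            GenTangent.IsComponents D U e W t (GenTangent.corrected g e t K)) ∧
      GenTangent.IsParallel D g := by
  refine ⟨GenTangent.metrization g D₀, fun U e W t hU hW he ht ↦ ⟨?_, fun K hK ↦ ?_⟩,
    GenTangent.isParallel_metrization g D₀⟩
  · exact GenTangent.exists_isComponents D₀ hU hW he ht
  · exact GenTangent.isComponents_metrization g D₀ hU hW he ht hK
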